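/- Let $\sigma,\Delta t,\lambda,P_0>0$ and $\mu\in\mathbb R$ with $\delta:=\lambda+\mu-\tfrac12\sigma^2>0$. Let the fundamental price be the geometric Brownian motion $P_t=P_0\exp\big((\mu-\tfrac12\sigma^2)t+\sigma W_t\big)$, $W$ a standard Brownian motion, let the ask price be $A_t=A_0e^{-\lambda t}$ with $A_0>0$, and let $z_t=\log(A_t/P_t)$. Blocks are generated at the arrival times of a Poisson process of rate $\Delta t^{-1}$ that is independent of $W$. Let $\tau_F$ be the earliest block generation time with $z_{\tau_F}\le 0$, and, as functions of the initial mispricing $z=\log(A_0/P_0)\in\mathbb R$ (with $A_0 = P_0e^{z}$), let $$\mathsf{LVF}(z)=\mathbb E\Big[\frac{P_{\tau_F}-A_{\tau_F}}{P_{\tau_F}}\,\Big|\,z_0=z\Big]=\mathbb E\big[1-e^{z_{\tau_F}}\mid z_0=z\big],\qquad \mathsf{FT}(z)=\mathbb E[\tau_F\mid z_0=z].$$ Then for every $z$ we have $\tau_F<\infty$ almost surely and both expectations exist and are finite, and $$\mathsf{LVF}(0)=\mathsf{LVF}_+:=\frac1{1+\frac{\delta}{\sigma^2}\Big(\sqrt{1+\frac{2\sigma^2}{\delta^2\Delta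 t}}-1\Big)},\qquad \mathsf{FT}(0)=\frac{\Delta t}{2}\Big(1+\sqrt{1+\frac{2\sigma^2}{\delta^2\Delta t}}\Big).$$ Let $z_0\sim N(\mu_0,\sigma_0^2)$ with $\mu_0\in\mathbb R$, $\sigma_0>0$, let $\Phi$ be the standard normal distribution function, and put $S=\sqrt{1+\frac{2\Delta t^{-1}\sigma^2}{\delta^2}}$. (a) If $\frac{\sigma^2}{2}-\delta-\Delta t^{-1}\neq0$, then $\mathsf{LVF}(z_0)$ is integrable and $$\begin{aligned}\mathbb E[\mathsf{LVF}(z_0)]={}&\mathsf{LVF}_++(1-\mathsf{LVF}_+)\,\Phi\Big(-\frac{\mu_0}{\sigma_0}\Big)+\frac{\Delta t^{-1}e^{\sigma_0^2/2}}{\frac{\sigma^2}{2}-\delta-\Delta t^{-1}}\,e^{\mu_0}\,\Phi\Big(-\sigma_0-\frac{\mu_0}{\sigma_0}\Big)\\&+\Big(\mathsf{LVF}_+-\frac{\frac{\sigma^2}{2}-\delta}{\frac{\sigma^2}{2}-\delta-\Delta t^{-1}}\Big)\exp\Big(\frac{\Delta t^{-1}\sigma_0^2}{\sigma^2}+\frac{\delta}{\sigma^2}\Big(\frac{\delta}{\sigma^2}\sigma_0^2+\mu_0\Big)(S+1)\Big)\,\Phi\Big(-\frac{\delta\sigma_0}{\sigma^2}(S+1)-\frac{\mu_0}{\sigma_0}\Big).\end{aligned}$$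 (b) $\mathsf{FT}(z_0)$ is integrable and $$\begin{aligned}\mathbb E[\mathsf{FT}(z_0)]={}&\Delta t+\frac{\sigma_0}{\delta\sqrt{2\pi}}e^{-\frac{\mu_0^2}{2\sigma_0^2}}+\Big(\mathsf{FT}(0)-\Delta t+\frac{\mu_0}{\delta}\Big)\Phi\Big(\frac{\mu_0}{\sigma_0}\Big)\\&+(\mathsf{FT}(0)-\Delta t)\exp\Big(2\Delta t^{-1}\mathsf{FT}(0)\Big(\frac{\sigma_0^2\delta^2}{\sigma^4}+\frac{\mu_0\delta}{\sigma^2}\Big)+\frac{\Delta t^{-1}\sigma_0^2}{\sigma^2}\Big)\,\Phi\Big(-\frac{2\Delta t^{-1}\mathsf{FT}(0)\,\sigma_0\,\delta}{\sigma^2}-\frac{\mu_0}{\sigma_0}\Big).\end{aligned}$$ -/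

import Mathlib

open MeasureTheory ProbabilityTheory
open scoped NNReal

noncomputable section

namespace DutchAuction

variable {Ω : Type*} [MeasurableSpace Ω]

/-- The gaps between consecutive block generation times `T 0, T 1, …`, the first one being counted
from time `0`. -/
def interarrival (T : ℕ → Ω → ℝ≥0) : ℕ → Ω → ℝ
  | 0, ω => (T 0 ω : ℝ)
  | n + 1, ω => (T (n + 1) ω : ℝ) - (T n ω : ℝ)

/-- `T 0, T 1, …` are the successive arrival times of a Poisson process of rate `r`: the
interarrival times are independent and exponentially distributed with rate `r`. -/
structure IsPoissonArrivals (T : ℕ → Ω → ℝ≥0) (r : ℝ) (Pr : Measure Ω) : Prop where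
  indep : iIndepFun (interarrival T) Pr
  hasLaw : ∀ n, HasLaw (interarrival T n) (expMeasure r) Pr

/-- Fundamental price at time `t`: the geometric Brownian motion with `dP = μ P dt + σ P dW`
started at `P₀`. -/
def fairPrice (μ σ P₀ : ℝ) (W : ℝ≥0 → Ω → ℝ) (t : ℝ≥0) (ω : Ω) : ℝ :=
  P₀ * Real.exp ((μ - σ ^ 2 / 2) * (t : ℝ) + σ * W t ω)

/-- Ask price at time `t`: exponential decay at rate `lam`, started at `A₀`. -/
def askPrice (lam A₀ : ℝ) (t : ℝ≥0) : ℝ :=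
  A₀ * Real.exp (-lam * (t : ℝ))

/-- The log mispricing `z_t = log (A_t / P_t)` before any trade. -/
def logMispricing (lam μ σ A₀ P₀ : ℝ) (W : ℝ≥0 → Ω → ℝ) (t : ℝ≥0) (ω : Ω) : ℝ :=
  Real.log (askPrice lam A₀ t / fairPrice μ σ P₀ W t ω)

/-- The fill time: the earliest block generation time at which the log mispricing is `≤ 0`
(the value is `T 0` if there is no such block). -/
def fillTime (lam μ σ A₀ P₀ : ℝ) (W : ℝ≥0 → Ω → ℝ) (T : ℕ → Ω → ℝ≥0) (ω : Ω) : ℝ≥0 :=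
  T (sInf {n : ℕ | logMispricing lam μ σ A₀ P₀ W (T n ω) ω ≤ 0}) ω

/-- The relative loss `(P - A) / P` of the seller at the fill time. -/
def relativeLoss (lam μ σ A₀ P₀ : ℝ) (W : ℝ≥0 → Ω → ℝ) (T : ℕ → Ω → ℝ≥0) (ω : Ω) : ℝ :=
  (fairPrice μ σ P₀ W (fillTime lam μ σ A₀ P₀ W T ω) ω
      - askPrice lam A₀ (fillTime lam μ σ A₀ P₀ W T ω))
    / fairPrice μ σ P₀ W (fillTime lam μ σ A₀ P₀ W T ω) ω

/-- Loss-versus-fair as a function of the initial log mispricing `z = log (A₀ / P₀)`. -/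
def LVF (lam μ σ P₀ : ℝ) (W : ℝ≥0 → Ω → ℝ) (T : ℕ → Ω → ℝ≥0) (Pr : Measure Ω) (z : ℝ) : ℝ :=
  ∫ ω, relativeLoss lam μ σ (P₀ * Real.exp z) P₀ W T ω ∂Pr

/-- Expected time-to-fill as a function of the initial log mispricing `z = log (A₀ / P₀)`. -/
def FT (lam μ σ P₀ : ℝ) (W : ℝ≥0 → Ω → ℝ) (T : ℕ → Ω → ℝ≥0) (Pr : Measure Ω) (z : ℝ) : ℝ :=
  ∫ ω, (fillTime lam μ σ (P₀ * Real.exp z) P₀ W T ω : ℝ) ∂Pr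

/-- The constant `LVF₊`. -/
def LVFplus (δ σ Δt : ℝ) : ℝ :=
  1 / (1 + δ / σ ^ 2 * (√(1 + 2 * σ ^ 2 / (δ ^ 2 * Δt)) - 1))

/-- The cumulative distribution function of the standard normal law. -/
def Φ (x : ℝ) : ℝ := cdf (gaussianReal 0 1) x

end DutchAuction

end

open DutchAuction

namespace DutchAuction

open Set Filter Topology
open scoped ENNReal

/-! Observed at block times, the log mispricing is a random walk whose steps are a drifted Brownian
motion run for an independent exponential time. Such a step has the law of `U - V` with `U`, `V`
independent exponentials of rates `a`, `b`, where `a` and `-b` are the roots of `σ² x² / 2 - δ x -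
Δt⁻¹` (`stepKernel_comp_expMeasure`, through characteristic functions). Since `b < a`, the walk
drifts down and its survival probability vanishes, by an exponential moment bound
(`IsExpWalk.setLIntegral_exp_le`).

Memorylessness of `V` makes both expectations explicit. From a positive level the undershoot at exit
is exponential of rate `b`, so the expected loss is `E[1 - e^{-V}] = 1 / (1 + b)`. Hence the loss
profile, extended by this constant above `0`, is preserved by one step from any positive level, and
the loss from `z` is a one-step integral (`IsExpWalk.lintegral_loss`). For the time, the profile `(y
+ 1/b)` on `y > 0` loses exactly `1/b - 1/a` in mean per step while the walk is alive. Telescoping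
counts the expected number of steps, and a Wald argument turns the count into time
(`IsExpWalk.lintegral_exit_time`).

Both values are exponentials below `0` and affine above it, so averaging over a Gaussian `z₀` only
needs truncated Gaussian integrals (`integral_lossValue`, `integral_fillValue`). The walk structure
itself comes from conditioning on the arrival times (`measure_inter_gapStep`, `exists_isExpWalk`).
-/

lemma lintegral_Ioi_of_hasDerivAt_of_nonneg {g g' : ℝ → ℝ} {c l : ℝ}
    (hderiv : ∀ x, HasDerivAt g (g' x) x) (hpos : ∀ x ∈ Ioi c, 0 ≤ g' x)
    (hl : Tendsto g atTop (𝓝 l)) :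
    ∫⁻ x in Ioi c, ENNReal.ofReal (g' x) = ENNReal.ofReal (l - g c) := by
  rw [← ofReal_integral_eq_lintegral_ofReal
    (integrableOn_Ioi_deriv_of_nonneg' (fun x _ => hderiv x) hpos hl)
    ((ae_restrict_iff' measurableSet_Ioi).2 (ae_of_all _ hpos)),
    integral_Ioi_of_hasDerivAt_of_nonneg' (fun x _ => hderiv x) hpos hl]

/-! ### Calculus for exponential laws. -/

lemma lintegral_expMeasure {a : ℝ} {f : ℝ → ℝ≥0∞} (hf : Measurable f) :
    ∫⁻ x, f x ∂expMeasure a = ∫⁻ x in Ioi 0, ENNReal.ofReal (a * Real.exp (-(a * x))) * f x := by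
  have h : expMeasure a = volume.withDensity (exponentialPDF a) := rfl
  have hm : Measurable (exponentialPDF a) := (measurable_exponentialPDFReal a).ennreal_ofReal
  rw [h, lintegral_withDensity_eq_lintegral_mul _ hm hf,
    ← setLIntegral_congr (Ioi_ae_eq_Ici (a := (0 : ℝ)) (μ := volume)).symm,
    ← lintegral_indicator measurableSet_Ici]
  refine lintegral_congr fun x => ?_
  by_cases hx : 0 ≤ x
  · simp [indicator, hx, exponentialPDF_of_nonneg hx]
  · simp [indicator, hx, exponentialPDF_of_neg (not_le.1 hx)]

lemma tendsto_exp_neg_mul_atTop {a : ℝ} (ha : 0 < a) :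
    Tendsto (fun x : ℝ => Real.exp (-(a * x))) atTop (𝓝 0) :=
  Real.tendsto_exp_neg_atTop_nhds_zero.comp (tendsto_id.const_mul_atTop ha)

lemma tendsto_mul_exp_neg_mul_atTop {a : ℝ} (ha : 0 < a) :
    Tendsto (fun x : ℝ => x * Real.exp (-(a * x))) atTop (𝓝 0) := by
  have h := (Real.tendsto_pow_mul_exp_neg_atTop_nhds_zero 1).comp
    (tendsto_id.const_mul_atTop ha)
  have h2 := h.const_mul (1 / a)
  rw [mul_zero] at h2
  refine h2.congr fun x => ?_
  simp
  field_simp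

lemma hasDerivAt_exp_neg_mul (a x : ℝ) :
    HasDerivAt (fun x : ℝ => Real.exp (-(a * x))) (-a * Real.exp (-(a * x))) x := by
  have := (((hasDerivAt_id x).const_mul a).neg).exp
  simpa [mul_comm] using this

lemma lintegral_Ioo_of_hasDerivAt_of_nonneg {g g' : ℝ → ℝ} {c d : ℝ} (hcd : c ≤ d)
    (hderiv : ∀ x, HasDerivAt g (g' x) x) (hcont : Continuous g')
    (hpos : ∀ x ∈ Ioo c d, 0 ≤ g' x) :
    ∫⁻ x in Ioo c d, ENNReal.ofReal (g' x) = ENNReal.ofReal (g d - g c) := by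
  rw [← ofReal_integral_eq_lintegral_ofReal
    (((intervalIntegrable_iff_integrableOn_Ioc_of_le hcd).1
      (hcont.intervalIntegrable c d)).mono_set Ioo_subset_Ioc_self)
    ((ae_restrict_iff' measurableSet_Ioo).2 (ae_of_all _ hpos)),
    ← integral_Ioc_eq_integral_Ioo, ← intervalIntegral.integral_of_le hcd,
    intervalIntegral.integral_eq_sub_of_hasDerivAt (fun x _ => hderiv x)
      (hcont.intervalIntegrable c d)]

lemma lintegral_Ioi_eq_Ioo_add_Ioi {c d : ℝ} (hcd : c ≤ d) (f : ℝ → ℝ≥0∞) :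
    ∫⁻ x in Ioi c, f x = (∫⁻ x in Ioo c d, f x) + ∫⁻ x in Ioi d, f x := by
  rw [← Ioc_union_Ioi_eq_Ioi hcd, lintegral_union measurableSet_Ioi
    (Set.disjoint_left.2 fun x hx hx' => not_lt.2 hx.2 hx'), setLIntegral_congr Ioo_ae_eq_Ioc]

/-! ### One-step expectations of the loss and height profiles. -/

/-- The relative loss realised at log mispricing `y ≤ 0`, extended by `c` to `y > 0`. -/
noncomputable def lossProfile (c y : ℝ) : ℝ := if y ≤ 0 then 1 - Real.exp y else c

/-- The shifted positive part `y + 1 / b` on `y > 0`. -/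
noncomputable def heightProfile (b y : ℝ) : ℝ := if 0 < y then y + 1 / b else 0

lemma measurable_lossProfile (c : ℝ) : Measurable (lossProfile c) :=
  Measurable.ite measurableSet_Iic (by fun_prop) (by fun_prop)

lemma measurable_heightProfile (b : ℝ) : Measurable (heightProfile b) :=
  Measurable.ite measurableSet_Ioi (by fun_prop) (by fun_prop)

lemma lintegral_ofReal_expMeasure {a : ℝ} (ha : 0 < a) {f : ℝ → ℝ} (hf : Measurable f) :
    ∫⁻ x, ENNReal.ofReal (f x) ∂expMeasure a =
      ∫⁻ x in Ioi 0, ENNReal.ofReal (a * Real.exp (-(a * x)) * f x) := by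
  rw [lintegral_expMeasure hf.ennreal_ofReal]
  refine lintegral_congr fun x => ?_
  rw [← ENNReal.ofReal_mul (by positivity)]

lemma lintegral_exp_mul_expMeasure {a θ : ℝ} (ha : 0 < a) (hθ : θ < a) :
    ∫⁻ x, ENNReal.ofReal (Real.exp (θ * x)) ∂expMeasure a = ENNReal.ofReal (a / (a - θ)) := by
  have h0 : 0 < a - θ := sub_pos.2 hθ
  rw [lintegral_ofReal_expMeasure ha (by fun_prop)]
  have hd : ∀ x, HasDerivAt (fun x => -(a / (a - θ)) * Real.exp (-((a - θ) * x)))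
      (a * Real.exp (-(a * x)) * Real.exp (θ * x)) x := fun x => by
    refine ((hasDerivAt_exp_neg_mul (a - θ) x).const_mul (-(a / (a - θ)))).congr_deriv ?_
    rw [mul_assoc a, ← Real.exp_add, show -(a * x) + θ * x = -((a - θ) * x) by ring]
    field_simp
  rw [lintegral_Ioi_of_hasDerivAt_of_nonneg hd (fun x _ => by positivity)
    ((tendsto_exp_neg_mul_atTop h0).const_mul _)]
  simp

lemma lintegral_lossProfile_tail {b w d : ℝ} (hb : 0 < b) (c : ℝ) (hd : w ≤ d) :
    ∫⁻ v in Ioi d, ENNReal.ofReal (b * Real.exp (-(b * v)) * lossProfile c (w - v)) =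
      ENNReal.ofReal (Real.exp (-(b * d)) - b / (b + 1) * Real.exp (w - (b + 1) * d)) := by
  have hder : ∀ v, HasDerivAt
      (fun v => -Real.exp (-(b * v)) + b / (b + 1) * Real.exp w * Real.exp (-((b + 1) * v)))
      (b * Real.exp (-(b * v)) * (1 - Real.exp (w - v))) v := fun v => by
    refine ((hasDerivAt_exp_neg_mul b v).neg.add
      ((hasDerivAt_exp_neg_mul (b + 1) v).const_mul (b / (b + 1) * Real.exp w))).congr_deriv ?_
    have h1 : Real.exp (-((b + 1) * v)) = Real.exp (-(b * v)) * Real.exp (-v) := by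
      rw [← Real.exp_add]; ring_nf
    rw [h1, Real.exp_sub, Real.exp_neg v]
    field_simp
    ring
  rw [setLIntegral_congr_fun (g := fun v =>
    ENNReal.ofReal (b * Real.exp (-(b * v)) * (1 - Real.exp (w - v)))) measurableSet_Ioi]
  · have hl := (tendsto_exp_neg_mul_atTop hb).neg.add
      ((tendsto_exp_neg_mul_atTop (by positivity : 0 < b + 1)).const_mul
        (b / (b + 1) * Real.exp w))
    rw [lintegral_Ioi_of_hasDerivAt_of_nonneg hder _ hl]
    · congr 1
      rw [Real.exp_sub, Real.exp_neg ((b + 1) * d)]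
      ring
    · intro v hv
      have : Real.exp (w - v) ≤ 1 := Real.exp_le_one_iff.2 (by linarith [mem_Ioi.1 hv])
      exact mul_nonneg (by positivity) (by linarith)
  · intro v hv
    have : w - v ≤ 0 := by linarith [mem_Ioi.1 hv]
    simp [lossProfile, this]

lemma lintegral_lossProfile_of_neg {b w : ℝ} (hb : 0 < b) (c : ℝ) (hw : w < 0) :
    ∫⁻ v, ENNReal.ofReal (lossProfile c (w - v)) ∂expMeasure b =
      ENNReal.ofReal (1 - b / (b + 1) * Real.exp w) := by
  rw [lintegral_ofReal_expMeasure hb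
      (f := fun v => lossProfile c (w - v))
      ((measurable_lossProfile c).comp (by fun_prop)),
    lintegral_lossProfile_tail hb c hw.le]
  simp

/-- Memorylessness: given `v > w`, the overshoot `v - w` is again exponential of rate `b`, with mean
loss `E[1 - e^{-V}] = 1 / (1 + b)`. The profile has this same value for `v < w`, so both pieces
average to it. -/
lemma lintegral_lossProfile_of_nonneg {b w : ℝ} (hb : 0 < b) (hw : 0 ≤ w) :
    ∫⁻ v, ENNReal.ofReal (lossProfile (1 / (1 + b)) (w - v)) ∂expMeasure b =
      ENNReal.ofReal (1 / (1 + b)) := by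
  rw [lintegral_ofReal_expMeasure hb
      (f := fun v => lossProfile (1 / (1 + b)) (w - v))
      ((measurable_lossProfile _).comp (by fun_prop)),
    lintegral_Ioi_eq_Ioo_add_Ioi hw, lintegral_lossProfile_tail hb _ le_rfl]
  have hder : ∀ v, HasDerivAt (fun v => -(1 / (1 + b)) * Real.exp (-(b * v)))
      (b * Real.exp (-(b * v)) * (1 / (1 + b))) v := fun v =>
    ((hasDerivAt_exp_neg_mul b v).const_mul (-(1 / (1 + b)))).congr_deriv (by ring)
  rw [setLIntegral_congr_fun (g := fun v =>
    ENNReal.ofReal (b * Real.exp (-(b * v)) * (1 / (1 + b)))) measurableSet_Ioo,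
    lintegral_Ioo_of_hasDerivAt_of_nonneg hw hder (by fun_prop) (fun v _ => by positivity)]
  · have h1 : Real.exp (w - (b + 1) * w) = Real.exp (-(b * w)) := by ring_nf
    have h2 : Real.exp (-(b * w)) ≤ 1 := Real.exp_le_one_iff.2 (by nlinarith)
    rw [h1, ← ENNReal.ofReal_add]
    · congr 1
      simp
      field_simp
      ring
    · simp
      field_simp
      linarith
    · rw [← one_sub_mul]
      have : 1 - b / (b + 1) = 1 / (b + 1) := by field_simp; ring
      rw [this]
      positivity
  · intro v hv
    have : ¬ w - v ≤ 0 := by linarith [hv.2]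
    simp [lossProfile, this]

/-- Averaging over an exponential drop of rate `b` is inverted by `g ↦ g + g' / b`. Applied to the
positive part of `w` this gives the height profile, which is where the shift `1 / b` comes from. -/
lemma lintegral_heightProfile {b : ℝ} (hb : 0 < b) (w : ℝ) :
    ∫⁻ v, ENNReal.ofReal (heightProfile b (w - v)) ∂expMeasure b = ENNReal.ofReal w := by
  rw [lintegral_ofReal_expMeasure hb
      (f := fun v => heightProfile b (w - v))
      ((measurable_heightProfile b).comp (by fun_prop))]
  have hz : ∀ d, w ≤ d → ∫⁻ v in Ioi d,
      ENNReal.ofReal (b * Real.exp (-(b * v)) * heightProfile b (w - v)) = 0 := fun d hd => by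
    rw [setLIntegral_congr_fun (g := fun _ => 0) measurableSet_Ioi, lintegral_zero]
    intro v hv
    have : ¬ v < w := by linarith [mem_Ioi.1 hv]
    simp [heightProfile, this]
  rcases le_total w 0 with hw | hw
  · rw [hz 0 hw, ENNReal.ofReal_of_nonpos hw]
  rw [lintegral_Ioi_eq_Ioo_add_Ioi hw, hz w le_rfl, add_zero]
  have hder : ∀ v, HasDerivAt (fun v => (v - w) * Real.exp (-(b * v)))
      (b * Real.exp (-(b * v)) * (w - v + 1 / b)) v := fun v => by
    refine (((hasDerivAt_id v).sub_const w).mul (hasDerivAt_exp_neg_mul b v)).congr_deriv ?_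
    simp
    field_simp
    ring
  rw [setLIntegral_congr_fun (g := fun v =>
    ENNReal.ofReal (b * Real.exp (-(b * v)) * (w - v + 1 / b))) measurableSet_Ioo,
    lintegral_Ioo_of_hasDerivAt_of_nonneg hw hder (by fun_prop)]
  · simp
  · intro v hv
    have : 0 ≤ w - v := by linarith [hv.2]
    positivity
  · intro v hv
    have : v < w := by linarith [hv.2]
    simp [heightProfile, this]

lemma lintegral_ofReal_add_tail {a z d : ℝ} (ha : 0 < a) (hd : 0 ≤ z + d) :
    ∫⁻ u in Ioi d, ENNReal.ofReal (a * Real.exp (-(a * u)) * (z + u)) =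
      ENNReal.ofReal ((z + d + 1 / a) * Real.exp (-(a * d))) := by
  have hder : ∀ u, HasDerivAt (fun u => -((z + 1 / a) * Real.exp (-(a * u)))
      - u * Real.exp (-(a * u))) (a * Real.exp (-(a * u)) * (z + u)) u := fun u => by
    refine (((hasDerivAt_exp_neg_mul a u).const_mul (z + 1 / a)).neg.sub
      ((hasDerivAt_id u).mul (hasDerivAt_exp_neg_mul a u))).congr_deriv ?_
    simp
    field_simp
    ring
  have hl := ((tendsto_exp_neg_mul_atTop ha).const_mul (z + 1 / a)).neg.sub
    (tendsto_mul_exp_neg_mul_atTop ha)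
  rw [lintegral_Ioi_of_hasDerivAt_of_nonneg hder _ hl]
  · congr 1
    ring
  · intro u hu
    have : 0 ≤ z + u := by linarith [mem_Ioi.1 hu]
    positivity

lemma lintegral_ofReal_add_of_nonneg {a z : ℝ} (ha : 0 < a) (hz : 0 ≤ z) :
    ∫⁻ u, ENNReal.ofReal (z + u) ∂expMeasure a = ENNReal.ofReal (z + 1 / a) := by
  rw [lintegral_ofReal_expMeasure ha (by fun_prop), lintegral_ofReal_add_tail ha (by simpa)]
  simp

lemma lintegral_ofReal_add_of_nonpos {a z : ℝ} (ha : 0 < a) (hz : z ≤ 0) :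
    ∫⁻ u, ENNReal.ofReal (z + u) ∂expMeasure a = ENNReal.ofReal (Real.exp (a * z) / a) := by
  rw [lintegral_ofReal_expMeasure ha (by fun_prop),
    lintegral_Ioi_eq_Ioo_add_Ioi (neg_nonneg.2 hz), lintegral_ofReal_add_tail ha (by simp),
    setLIntegral_congr_fun (g := fun _ => 0) measurableSet_Ioo, lintegral_zero]
  · simp
    congr 1
    field_simp
  · intro u hu
    have h : z + u ≤ 0 := by linarith [hu.2]
    exact ENNReal.ofReal_of_nonpos (mul_nonpos_of_nonneg_of_nonpos (by positivity) h)

/-- The expected loss from initial log mispricing `z`, in terms of the exponential rates `a`, `b`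
of the upward and downward parts of a step. -/
noncomputable def lossValue (a b z : ℝ) : ℝ :=
  if z ≤ 0 then 1 - b / (b + 1) * a / (a - 1) * Real.exp z
    + (b / (b + 1) * a / (a - 1) - b / (b + 1)) * Real.exp (a * z) else 1 / (1 + b)

lemma lintegral_lossProfile_sub_of_nonneg {a b z : ℝ} (ha : 0 < a) (hb : 0 < b) (hz : 0 ≤ z) :
    ∫⁻ u, ∫⁻ v, ENNReal.ofReal (lossProfile (1 / (1 + b)) (z + (u - v))) ∂expMeasure b
      ∂expMeasure a = ENNReal.ofReal (1 / (1 + b)) := by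
  have hp := isProbabilityMeasure_expMeasure ha
  rw [lintegral_expMeasure]
  · rw [setLIntegral_congr_fun (g := fun u => ENNReal.ofReal (a * Real.exp (-(a * u))) *
      ENNReal.ofReal (1 / (1 + b))) measurableSet_Ioi]
    · rw [← lintegral_expMeasure measurable_const]
      simp
    · intro u hu
      have hu' : 0 ≤ z + u := by linarith [mem_Ioi.1 hu]
      simp only [← add_sub_assoc]
      rw [lintegral_lossProfile_of_nonneg hb hu']
  · have := isProbabilityMeasure_expMeasure hb
    exact Measurable.lintegral_prod_right'
      (f := fun p : ℝ × ℝ => ENNReal.ofReal (lossProfile (1 / (1 + b)) (z + (p.1 - p.2))))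
      ((measurable_lossProfile _).comp (g := lossProfile (1 / (1 + b)))
        (f := fun p : ℝ × ℝ => z + (p.1 - p.2)) (by fun_prop)).ennreal_ofReal

/-- The upward part `u` either leaves `z + u` below `0` or carries it above, so the integral is cut
at `u = -z`. For `a = 1` the exponentials `e^z` and `e^{az}` coincide and the formula degenerates.
-/
lemma lintegral_lossProfile_sub_of_neg {a b z : ℝ} (ha : 0 < a) (ha1 : a ≠ 1) (hb : 0 < b)
    (hz : z < 0) :
    (∫⁻ u, ∫⁻ v, ENNReal.ofReal (lossProfile (1 / (1 + b)) (z + (u - v))) ∂expMeasure b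
      ∂expMeasure a).toReal = lossValue a b z := by
  have hz' : 0 ≤ -z := by linarith
  have hk : 0 < b / (b + 1) := by positivity
  have hk1 : b / (b + 1) < 1 := by rw [div_lt_one (by positivity)]; linarith
  have hc : 1 / (1 + b) = 1 - b / (b + 1) := by field_simp; ring
  have ha1' : a - 1 ≠ 0 := sub_ne_zero.2 ha1
  rw [lintegral_expMeasure]
  · rw [lintegral_Ioi_eq_Ioo_add_Ioi hz',
      setLIntegral_congr_fun (s := Ioo 0 (-z)) (g := fun u =>
        ENNReal.ofReal (a * Real.exp (-(a * u)) * (1 - b / (b + 1) * Real.exp (z + u))))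
        measurableSet_Ioo,
      setLIntegral_congr_fun (s := Ioi (-z)) (g := fun u =>
        ENNReal.ofReal (a * Real.exp (-(a * u)) * (1 / (1 + b)))) measurableSet_Ioi]
    · have hd1 : ∀ u, HasDerivAt (fun u => -Real.exp (-(a * u))
          + b / (b + 1) * a / (a - 1) * Real.exp z * Real.exp (-((a - 1) * u)))
          (a * Real.exp (-(a * u)) * (1 - b / (b + 1) * Real.exp (z + u))) u := fun u => by
        refine ((hasDerivAt_exp_neg_mul a u).neg.add ((hasDerivAt_exp_neg_mul (a - 1) u).const_mul
          (b / (b + 1) * a / (a - 1) * Real.exp z))).congr_deriv ?_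
        have h1 : Real.exp (-((a - 1) * u)) = Real.exp (-(a * u)) * Real.exp u := by
          rw [← Real.exp_add]; ring_nf
        rw [h1, Real.exp_add]
        field_simp
        ring
      have hd2 : ∀ u, HasDerivAt (fun u => -(1 / (1 + b)) * Real.exp (-(a * u)))
          (a * Real.exp (-(a * u)) * (1 / (1 + b))) u := fun u =>
        ((hasDerivAt_exp_neg_mul a u).const_mul (-(1 / (1 + b)))).congr_deriv (by ring)
      have hn : ∀ u ∈ Ioo 0 (-z),
          0 ≤ a * Real.exp (-(a * u)) * (1 - b / (b + 1) * Real.exp (z + u)) := fun u hu => by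
        have : Real.exp (z + u) ≤ 1 := Real.exp_le_one_iff.2 (by linarith [hu.2])
        exact mul_nonneg (by positivity) (by nlinarith)
      have hmono := (lintegral_Ioo_of_hasDerivAt_of_nonneg hz' hd1 (by fun_prop) hn)
      -- The sign of the antiderivative difference is read off from the integral it equals; it is
      -- needed to add the two `ENNReal.ofReal` terms.
      have hge : 0 ≤ ∫ u in Ioo 0 (-z),
          a * Real.exp (-(a * u)) * (1 - b / (b + 1) * Real.exp (z + u)) :=
        setIntegral_nonneg measurableSet_Ioo hn
      rw [← integral_Ioc_eq_integral_Ioo, ← intervalIntegral.integral_of_le hz',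
        intervalIntegral.integral_eq_sub_of_hasDerivAt (fun x _ => hd1 x)
          (Continuous.intervalIntegrable (by fun_prop) _ _)] at hge
      have hge2 : 0 ≤ -(1 / (1 + b)) * 0 - -(1 / (1 + b)) * Real.exp (-(a * -z)) := by
        rw [mul_zero, zero_sub, neg_mul, neg_neg]
        positivity
      rw [hmono, lintegral_Ioi_of_hasDerivAt_of_nonneg hd2 (fun u _ => by positivity)
        ((tendsto_exp_neg_mul_atTop ha).const_mul _), ← ENNReal.ofReal_add hge hge2,
        ENNReal.toReal_ofReal (add_nonneg hge hge2)]
      have h2 : Real.exp (-((a - 1) * -z)) = Real.exp (a * z) * (Real.exp z)⁻¹ := by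
        rw [← Real.exp_neg, ← Real.exp_add]; ring_nf
      have h3 : Real.exp (-(a * -z)) = Real.exp (a * z) := by ring_nf
      have h4 : Real.exp z * (Real.exp z)⁻¹ = 1 := mul_inv_cancel₀ (Real.exp_ne_zero z)
      simp only [lossValue, hz.le, if_true, h2, h3, hc]
      simp only [mul_zero, neg_zero, Real.exp_zero]
      linear_combination (b / (b + 1) * a / (a - 1) * Real.exp (a * z)) * h4
    · intro u hu
      have hu' : 0 ≤ z + u := by linarith [mem_Ioi.1 hu]
      simp only [← add_sub_assoc]
      rw [lintegral_lossProfile_of_nonneg hb hu', ← ENNReal.ofReal_mul (by positivity)]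
    · intro u hu
      have hu' : z + u < 0 := by linarith [hu.2]
      simp only [← add_sub_assoc]
      rw [lintegral_lossProfile_of_neg hb _ hu', ← ENNReal.ofReal_mul (by positivity)]
  · have := isProbabilityMeasure_expMeasure hb
    exact Measurable.lintegral_prod_right'
      (f := fun p : ℝ × ℝ => ENNReal.ofReal (lossProfile (1 / (1 + b)) (z + (p.1 - p.2))))
      ((measurable_lossProfile _).comp (g := lossProfile (1 / (1 + b)))
        (f := fun p : ℝ × ℝ => z + (p.1 - p.2)) (by fun_prop)).ennreal_ofReal

/-! ### The law of a single step, by characteristic functions. -/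

lemma integral_expMeasure {E : Type*} [NormedAddCommGroup E] [NormedSpace ℝ E] {a : ℝ}
    (ha : 0 < a) (f : ℝ → E) :
    ∫ x, f x ∂expMeasure a = ∫ x in Ioi 0, (a * Real.exp (-(a * x))) • f x := by
  have h : expMeasure a = volume.withDensity (exponentialPDF a) := rfl
  have hm : Measurable (exponentialPDF a) := (measurable_exponentialPDFReal a).ennreal_ofReal
  rw [h, integral_withDensity_eq_integral_toReal_smul hm
    (ae_of_all _ fun x => ENNReal.ofReal_lt_top), ← integral_Ici_eq_integral_Ioi,
    ← integral_indicator measurableSet_Ici]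
  refine integral_congr_ae (ae_of_all _ fun x => ?_)
  by_cases hx : 0 ≤ x
  · have : 0 ≤ a * Real.exp (-(a * x)) := by positivity
    simp [indicator, hx, exponentialPDF_of_nonneg hx, ENNReal.toReal_ofReal this]
  · simp [indicator, hx, exponentialPDF_of_neg (not_le.1 hx)]

lemma integral_cexp_mul_expMeasure {a : ℝ} (ha : 0 < a) {s : ℂ} (hs : s.re < a) :
    ∫ x : ℝ, Complex.exp (s * x) ∂expMeasure a = a / (a - s) := by
  rw [integral_expMeasure ha]
  have h1 : (s - a).re < 0 := by simpa using hs
  have h2 : ∀ x : ℝ, (a * Real.exp (-(a * x))) • Complex.exp (s * x) =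
      a * Complex.exp ((s - a) * x) := fun x => by
    rw [Complex.real_smul, sub_mul, sub_eq_add_neg, Complex.exp_add]
    push_cast
    ring
  simp_rw [h2]
  rw [integral_const_mul, integral_exp_mul_complex_Ioi h1]
  have h3 : s - a ≠ 0 := fun h => by simp [h] at h1
  have h4 : (a : ℂ) - s ≠ 0 := by rw [← neg_sub]; exact neg_ne_zero.2 h3
  simp
  field_simp
  ring

lemma ae_nonneg_expMeasure (a : ℝ) : ∀ᵐ x ∂expMeasure a, 0 ≤ x := by
  have h : expMeasure a (Iio 0) = 0 := by
    have h : expMeasure a = volume.withDensity (exponentialPDF a) := rfl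
    rw [h, withDensity_apply _ measurableSet_Iio, lintegral_exponentialPDF_of_nonpos le_rfl]
  rw [ae_iff]
  convert h using 2
  ext x
  simp

/-- The law of the difference of independent exponential variables with rates `a` and `b`. -/
noncomputable def expDiff (a b : ℝ) : Measure ℝ :=
  ((expMeasure a).prod (expMeasure b)).map (fun p => p.1 - p.2)

lemma isProbabilityMeasure_expDiff {a b : ℝ} (ha : 0 < a) (hb : 0 < b) :
    IsProbabilityMeasure (expDiff a b) := by
  have := isProbabilityMeasure_expMeasure ha
  have := isProbabilityMeasure_expMeasure hb
  exact Measure.isProbabilityMeasure_map (by fun_prop)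

lemma lintegral_expDiff {a b : ℝ} (hb : 0 < b) {f : ℝ → ℝ≥0∞} (hf : Measurable f) :
    ∫⁻ x, f x ∂expDiff a b = ∫⁻ u, ∫⁻ v, f (u - v) ∂expMeasure b ∂expMeasure a := by
  have := isProbabilityMeasure_expMeasure hb
  rw [expDiff, lintegral_map hf (by fun_prop), lintegral_prod]
  exact (hf.comp (by fun_prop)).aemeasurable

lemma charFun_expDiff {a b : ℝ} (ha : 0 < a) (hb : 0 < b) (t : ℝ) :
    charFun (expDiff a b) t = a / (a - t * Complex.I) * (b / (b + t * Complex.I)) := by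
  have := isProbabilityMeasure_expMeasure ha
  have := isProbabilityMeasure_expMeasure hb
  rw [charFun_apply_real, expDiff, integral_map (by fun_prop) (by fun_prop)]
  have h : ∀ p : ℝ × ℝ, Complex.exp (t * (p.1 - p.2 : ℝ) * Complex.I) =
      Complex.exp (t * Complex.I * p.1) * Complex.exp (-(t * Complex.I) * p.2) := fun p => by
    rw [← Complex.exp_add]
    push_cast
    ring_nf
  simp_rw [h]
  rw [integral_prod_mul (fun x : ℝ => Complex.exp (t * Complex.I * x))
    (fun x : ℝ => Complex.exp (-(t * Complex.I) * x)),
    integral_cexp_mul_expMeasure ha (by simpa), integral_cexp_mul_expMeasure hb (by simpa)]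
  simp

/-- The law of the increment of `-δ t - σ W_t` over a time interval of length `e`. -/
noncomputable def stepKernel (δ σ : ℝ) : Kernel ℝ ℝ where
  toFun e := gaussianReal (-δ * e) (Real.toNNReal (σ ^ 2 * e))
  measurable' := measurable_gaussianReal.comp
    (f := fun e : ℝ => (-δ * e, Real.toNNReal (σ ^ 2 * e))) (by fun_prop)

lemma stepKernel_apply (δ σ e : ℝ) :
    stepKernel δ σ e = gaussianReal (-δ * e) (Real.toNNReal (σ ^ 2 * e)) := rfl

instance (δ σ : ℝ) : IsMarkovKernel (stepKernel δ σ) :=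
  ⟨fun e => by rw [stepKernel_apply]; infer_instance⟩

/-- The mixture has characteristic function `r / (r + iδt + σ²t²/2)`. The two relations on `r` and
`δ` factor the denominator as `(σ²/2)(a - it)(b + it)`, which splits it into the characteristic
functions of `U` and `-V`. -/
lemma stepKernel_comp_expMeasure {a b r δ σ : ℝ} (ha : 0 < a) (hb : 0 < b) (hσ : 0 < σ)
    (hr : r = σ ^ 2 * (a * b) / 2) (hδ : δ = σ ^ 2 * (a - b) / 2) :
    (expMeasure r).bind (stepKernel δ σ) = expDiff a b := by
  have hr0 : 0 < r := by rw [hr]; positivity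
  have := isProbabilityMeasure_expMeasure hr0
  have := isProbabilityMeasure_expDiff ha hb
  refine Measure.ext_of_charFun (funext fun t => ?_)
  rw [charFun_expDiff ha hb, charFun_apply_real, Measure.comp_eq_comp_const_apply, Kernel.integral_comp,
    Kernel.const_apply]
  · have h : ∀ᵐ e ∂expMeasure r, ∫ x : ℝ, Complex.exp (t * x * Complex.I) ∂stepKernel δ σ e =
        Complex.exp ((-(δ * t * Complex.I) - σ ^ 2 * t ^ 2 / 2) * e) := by
      filter_upwards [ae_nonneg_expMeasure r] with e he
      rw [stepKernel_apply, ← charFun_apply_real, charFun_gaussianReal,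
        Real.coe_toNNReal _ (by positivity)]
      push_cast
      ring_nf
    rw [integral_congr_ae h, integral_cexp_mul_expMeasure hr0]
    · have h1 : (a : ℂ) - t * Complex.I ≠ 0 := fun h => by
        have := congrArg Complex.re h
        simp at this
        exact ha.ne' this
      have h2 : (b : ℂ) + t * Complex.I ≠ 0 := fun h => by
        have := congrArg Complex.re h
        simp at this
        exact hb.ne' this
      have h3 : (r : ℂ) - (-(δ * t * Complex.I) - σ ^ 2 * t ^ 2 / 2) =
          σ ^ 2 / 2 * ((a - t * Complex.I) * (b + t * Complex.I)) := by
        rw [hr, hδ]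
        push_cast
        linear_combination ((σ : ℂ) ^ 2 * t ^ 2 / 2) * Complex.I_sq
      have h4 : (σ : ℂ) ≠ 0 := by exact_mod_cast hσ.ne'
      rw [h3, hr]
      push_cast
      field_simp
    · have h5 : (-(δ * t * Complex.I) - (σ : ℂ) ^ 2 * t ^ 2 / 2).re = -(σ ^ 2 * t ^ 2 / 2) := by
        have : (-(δ * t * Complex.I) - (σ : ℂ) ^ 2 * t ^ 2 / 2) =
          ((-(σ ^ 2 * t ^ 2 / 2) : ℝ) : ℂ) + ((-(δ * t) : ℝ) : ℂ) * Complex.I := by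
          push_cast; ring
        rw [this, Complex.add_re, Complex.ofReal_re, Complex.re_ofReal_mul]
        simp
      rw [h5]
      have : 0 ≤ σ ^ 2 * t ^ 2 / 2 := by positivity
      linarith
  · rw [← Measure.comp_eq_comp_const_apply]
    refine (integrable_const (1 : ℝ)).mono (by fun_prop) (ae_of_all _ fun x => ?_)
    rw [← Complex.ofReal_mul, Complex.norm_exp_ofReal_mul_I]
    simp

/-! ### Independence and law of the (gap, step) pairs. -/

/-- The value at time `t` of a path given at the dyadic times `k / 2 ^ m`. -/
noncomputable def evalDyadic (w : ℕ × ℕ → ℝ) (t : ℝ≥0) : ℝ :=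
  limsup (fun m : ℕ => w (⌈(t : ℝ) * 2 ^ m⌉₊, m)) atTop

/-- The restriction of a path to the dyadic times `k / 2 ^ m`. -/
noncomputable def dyadicPath (f : ℝ≥0 → ℝ) (p : ℕ × ℕ) : ℝ := f (p.1 / 2 ^ p.2)

/-- Evaluation `(w, t) ↦ w t` is not jointly measurable for the product σ-algebra on all functions
of `t`. It becomes so on countably many dyadic coordinates, which determine a continuous path. -/
lemma measurable_evalDyadic :
    Measurable (fun p : (ℕ × ℕ → ℝ) × ℝ≥0 => evalDyadic p.1 p.2) := by
  refine Measurable.limsup fun m => ?_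
  have h1 : Measurable (fun q : (ℕ × ℕ → ℝ) × ℕ => q.1 (q.2, m)) :=
    measurable_from_prod_countable_left fun k => measurable_pi_apply (k, m)
  exact h1.comp (f := fun p : (ℕ × ℕ → ℝ) × ℝ≥0 => (p.1, ⌈(p.2 : ℝ) * 2 ^ m⌉₊)) (by fun_prop)

lemma evalDyadic_dyadicPath {f : ℝ≥0 → ℝ} (hf : Continuous f) (t : ℝ≥0) :
    evalDyadic (dyadicPath f) t = f t := by
  refine Tendsto.limsup_eq ?_
  refine (hf.tendsto t).comp (f := fun m : ℕ => ((⌈(t : ℝ) * 2 ^ m⌉₊ : ℝ≥0) / 2 ^ m)) ?_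
  refine NNReal.tendsto_coe.1 ?_
  push_cast
  exact (tendsto_nat_ceil_mul_div_atTop t.2).comp
    (tendsto_pow_atTop_atTop_of_one_lt (one_lt_two))

/-- The time preceding `t n` in the sequence `0, t 0, t 1, …`. -/
def prevTime (t : ℕ → ℝ≥0) : ℕ → ℝ≥0
  | 0 => 0
  | n + 1 => t n

lemma interarrival_eq {Ω : Type*} [MeasurableSpace Ω] (T : ℕ → Ω → ℝ≥0) (n : ℕ) (ω : Ω) :
    interarrival T n ω = T n ω - prevTime (fun k => T k ω) n := by
  cases n <;> simp [interarrival, prevTime]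

/-- The gap preceding the `n`-th arrival together with the change of `-δ t - σ w t` over it. -/
def gapStep (δ σ : ℝ) (w : ℝ≥0 → ℝ) (t : ℕ → ℝ≥0) (n : ℕ) : ℝ × ℝ :=
  ((t n : ℝ) - prevTime t n,
    -δ * ((t n : ℝ) - prevTime t n) - σ * (w (t n) - w (prevTime t n)))

lemma measurable_prevTime (n : ℕ) : Measurable (fun t : ℕ → ℝ≥0 => prevTime t n) := by
  cases n with
  | zero => exact measurable_const
  | succ n => exact measurable_pi_apply n

lemma measurable_gapStep_evalDyadic (δ σ : ℝ) (n : ℕ) :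
    Measurable (fun p : (ℕ × ℕ → ℝ) × (ℕ → ℝ≥0) => gapStep δ σ (evalDyadic p.1) p.2 n) := by
  have h0 : Measurable (fun p : (ℕ × ℕ → ℝ) × (ℕ → ℝ≥0) => prevTime p.2 n) :=
    (measurable_prevTime n).comp measurable_snd
  have h1 : Measurable (fun p : (ℕ × ℕ → ℝ) × (ℕ → ℝ≥0) => p.2 n) := by fun_prop
  have h2 := measurable_evalDyadic.comp (measurable_fst.prodMk h0)
  have h3 := measurable_evalDyadic.comp (measurable_fst.prodMk h1)
  have h4 : Measurable (fun p : (ℕ × ℕ → ℝ) × (ℕ → ℝ≥0) => (p.2 n : ℝ) - prevTime p.2 n) :=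
    h1.coe_nnreal_real.sub h0.coe_nnreal_real
  exact h4.prodMk ((h4.const_mul (-δ)).sub ((h3.sub h2).const_mul σ))

lemma gapStep_evalDyadic_dyadicPath {w : ℝ≥0 → ℝ} (hw : Continuous w) (δ σ : ℝ) (t : ℕ → ℝ≥0)
    (n : ℕ) : gapStep δ σ (evalDyadic (dyadicPath w)) t n = gapStep δ σ w t n := by
  simp [gapStep, evalDyadic_dyadicPath hw]

section

variable {Ω : Type*} [MeasurableSpace Ω] {Pr : Measure Ω}

lemma IsPoissonArrivals.aemeasurable {T : ℕ → Ω → ℝ≥0} {r : ℝ}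
    (hT : IsPoissonArrivals T r Pr) (n : ℕ) : AEMeasurable (T n) Pr := by
  have h : AEMeasurable (fun ω => (T n ω : ℝ)) Pr := by
    induction n with
    | zero => exact (hT.hasLaw 0).aemeasurable
    | succ n ih =>
      refine (ih.add (hT.hasLaw (n + 1)).aemeasurable).congr (ae_of_all _ fun ω => ?_)
      simp [interarrival]
  exact h.real_toNNReal.congr (ae_of_all _ fun ω => by simp)

lemma IsPoissonArrivals.ae_monotone {T : ℕ → Ω → ℝ≥0} {r : ℝ}
    (hT : IsPoissonArrivals T r Pr) : ∀ᵐ ω ∂Pr, Monotone (fun n => T n ω) := by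
  have h : ∀ᵐ ω ∂Pr, ∀ n, 0 ≤ interarrival T n ω := ae_all_iff.2 fun n => by
    have := (hT.hasLaw n).ae_iff (p := fun x => 0 ≤ x) (measurableSet_Ici.mem)
    exact this.2 (ae_nonneg_expMeasure r)
  filter_upwards [h] with ω hω
  refine monotone_nat_of_le_succ fun n => ?_
  have := hω (n + 1)
  simpa [interarrival] using this

lemma prevTime_monotone {t : ℕ → ℝ≥0} (ht : Monotone t) : Monotone (prevTime t) :=
  monotone_nat_of_le_succ fun n => by
    cases n with
    | zero => simp [prevTime]
    | succ n => exact ht (Nat.le_succ n)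

/-- The case of frozen arrival times, where independence of Brownian increments applies directly. -/
lemma measure_inter_gapStep_of_monotone {W : ℝ≥0 → Ω → ℝ} (hW : IsBrownianReal W Pr)
    (δ σ : ℝ) {t : ℕ → ℝ≥0} (ht : Monotone t) (s : Finset ℕ) {D : ℕ → Set (ℝ × ℝ)}
    (hD : ∀ i, MeasurableSet (D i)) :
    Pr (⋂ i ∈ s, {ω | gapStep δ σ (fun u => W u ω) t i ∈ D i}) =
      ∏ i ∈ s, stepKernel δ σ ((t i : ℝ) - prevTime t i)
        (Prod.mk ((t i : ℝ) - prevTime t i) ⁻¹' D i) := by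
  have hmono := prevTime_monotone ht
  have hind := hW.hasIndepIncrements.nat hmono
  have hm : ∀ i, Measurable (fun x : ℝ => ((t i : ℝ) - prevTime t i,
      -δ * ((t i : ℝ) - prevTime t i) - σ * x)) := fun i => by fun_prop
  have h1 := iIndepFun_iff_measure_inter_preimage_eq_mul.1 hind s
    (sets := fun i => (fun x : ℝ => ((t i : ℝ) - prevTime t i,
      -δ * ((t i : ℝ) - prevTime t i) - σ * x)) ⁻¹' D i) fun i _ => hm i (hD i)
  refine h1.trans (Finset.prod_congr rfl fun i _ => ?_)
  have h0 : (0 : ℝ) ≤ (t i : ℝ) - prevTime t i := sub_nonneg.2 (by exact_mod_cast hmono (Nat.le_succ i))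
  have hlaw : HasLaw (fun ω => -δ * ((t i : ℝ) - prevTime t i) +
      -σ * (W (prevTime t (i + 1)) ω - W (prevTime t i) ω))
      (stepKernel δ σ ((t i : ℝ) - prevTime t i)) Pr := by
    have h2 := gaussianReal_const_add (gaussianReal_const_mul
      (hW.hasLaw_sub (prevTime t (i + 1)) (prevTime t i)) (-σ)) (-δ * ((t i : ℝ) - prevTime t i))
    convert! h2 using 1
    rw [stepKernel_apply]
    congr 1
    · simp
    · ext
      have h3 : ((prevTime t (i + 1) : ℝ≥0) : ℝ) = t i := rfl
      simp [Real.dist_eq, abs_of_nonneg h0, Real.coe_toNNReal _ (mul_nonneg (sq_nonneg σ) h0), h3]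
  refine Eq.trans ?_ (hlaw.measure_eq ((hD i).preimage measurable_prodMk_left))
  congr 1
  ext ω
  simp [sub_eq_add_neg]

lemma lintegral_prod_comp_of_iIndepFun {X : ℕ → Ω → ℝ} (hX : iIndepFun X Pr)
    (hm : ∀ i, AEMeasurable (X i) Pr) (s : Finset ℕ) {g : ℕ → ℝ → ℝ≥0∞}
    (hg : ∀ i, Measurable (g i)) :
    ∫⁻ ω, ∏ i ∈ s, g i (X i ω) ∂Pr = ∏ i ∈ s, ∫⁻ ω, g i (X i ω) ∂Pr := by
  have h1 : iIndepFun (fun i => g i ∘ (hm i).mk) Pr :=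
    (hX.congr fun i => (hm i).ae_eq_mk).comp _ hg
  have h2 := lintegral_prod_eq_prod_lintegral_of_indepFun s _ h1
    fun i => (hg i).comp (hm i).measurable_mk
  have h3 : ∀ᵐ ω ∂Pr, ∀ i, X i ω = (hm i).mk (X i) ω := ae_all_iff.2 fun i => (hm i).ae_eq_mk
  have h4 : ∀ i, ∫⁻ ω, g i (X i ω) ∂Pr = ∫⁻ ω, (g i ∘ (hm i).mk) ω ∂Pr := fun i => by
    refine lintegral_congr_ae ?_
    filter_upwards [h3] with ω hω
    simp [← hω i]
  simp_rw [h4]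
  rw [← h2]
  refine lintegral_congr_ae ?_
  filter_upwards [h3] with ω hω
  simp [← hω]

lemma aemeasurable_dyadicPath {W : ℝ≥0 → Ω → ℝ} (hW : IsBrownianReal W Pr) :
    AEMeasurable (fun ω => dyadicPath (fun u => W u ω)) Pr :=
  aemeasurable_pi_iff.2 fun p => hW.aemeasurable (p.1 / 2 ^ p.2)

lemma aemeasurable_gapStep [IsProbabilityMeasure Pr] {W : ℝ≥0 → Ω → ℝ} (hW : IsBrownianReal W Pr)
    {T : ℕ → Ω → ℝ≥0} {r : ℝ} (hT : IsPoissonArrivals T r Pr) (δ σ : ℝ) (n : ℕ) :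
    AEMeasurable (fun ω => gapStep δ σ (fun u => W u ω) (fun k => T k ω) n) Pr := by
  have h := (measurable_gapStep_evalDyadic δ σ n).comp_aemeasurable
    ((aemeasurable_dyadicPath hW).prodMk (aemeasurable_pi_iff.2 hT.aemeasurable))
  refine h.congr ?_
  filter_upwards [hW.cont] with ω hω
  simp [gapStep_evalDyadic_dyadicPath hω]

/-- Fubini over the law of `T`: with the times frozen, the probability is a product of functions of
the separate interarrival times, and their independence factors its expectation. -/
lemma measure_inter_gapStep [IsProbabilityMeasure Pr] {W : ℝ≥0 → Ω → ℝ}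
    (hW : IsBrownianReal W Pr) {T : ℕ → Ω → ℝ≥0} {r : ℝ} (hr : 0 < r)
    (hT : IsPoissonArrivals T r Pr)
    (hWT : IndepFun (fun ω (t : ℝ≥0) => W t ω) (fun ω (n : ℕ) => T n ω) Pr) (δ σ : ℝ)
    (s : Finset ℕ) {D : ℕ → Set (ℝ × ℝ)} (hD : ∀ i, MeasurableSet (D i)) :
    Pr (⋂ i ∈ s, {ω | gapStep δ σ (fun u => W u ω) (fun k => T k ω) i ∈ D i}) =
      ∏ i ∈ s, (expMeasure r ⊗ₘ stepKernel δ σ) (D i) := by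
  have := isProbabilityMeasure_expMeasure hr
  have hV := aemeasurable_dyadicPath hW
  have hTm : AEMeasurable (fun ω (k : ℕ) => T k ω) Pr := aemeasurable_pi_iff.2 hT.aemeasurable
  have hind : IndepFun (fun ω => dyadicPath (fun u => W u ω)) (fun ω (k : ℕ) => T k ω) Pr :=
    hWT.comp (φ := dyadicPath) (ψ := id)
      (measurable_pi_iff.2 fun p => measurable_pi_apply _) measurable_id
  let A : Set ((ℕ × ℕ → ℝ) × (ℕ → ℝ≥0)) :=
    ⋂ i ∈ s, (fun p => gapStep δ σ (evalDyadic p.1) p.2 i) ⁻¹' D i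
  have hA : MeasurableSet A := Finset.measurableSet_biInter s fun i _ =>
    measurable_gapStep_evalDyadic δ σ i (hD i)
  have h1 : Pr (⋂ i ∈ s, {ω | gapStep δ σ (fun u => W u ω) (fun k => T k ω) i ∈ D i}) =
      (Pr.map (fun ω => (dyadicPath (fun u => W u ω), fun k => T k ω))) A := by
    rw [Measure.map_apply_of_aemeasurable (hV.prodMk hTm) hA]
    refine measure_congr (eventuallyEq_set.2 ?_)
    filter_upwards [hW.cont] with ω hω
    simp [A, gapStep_evalDyadic_dyadicPath hω]
  rw [h1, hind.map_prod_eq_prod_map_map hV hTm, Measure.prod_apply_symm hA,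
    lintegral_map' (measurable_measure_prodMk_right hA).aemeasurable hTm]
  have h2 : ∀ᵐ ω' ∂Pr, (Pr.map (fun ω => dyadicPath (fun u => W u ω)))
      ((fun x => (x, fun k => T k ω')) ⁻¹' A) =
      ∏ i ∈ s, stepKernel δ σ (interarrival T i ω') (Prod.mk (interarrival T i ω') ⁻¹' D i) := by
    filter_upwards [hT.ae_monotone] with ω' hω'
    simp_rw [interarrival_eq]
    rw [← measure_inter_gapStep_of_monotone hW δ σ hω' s hD,
      Measure.map_apply_of_aemeasurable hV (hA.preimage measurable_prodMk_right)]
    refine measure_congr (eventuallyEq_set.2 ?_)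
    filter_upwards [hW.cont] with ω hω
    simp [A, gapStep_evalDyadic_dyadicPath hω]
  have hg : ∀ i, Measurable (fun e => stepKernel δ σ e (Prod.mk e ⁻¹' D i)) := fun i =>
    Kernel.measurable_kernel_prodMk_left (hD i)
  rw [lintegral_congr_ae h2, lintegral_prod_comp_of_iIndepFun hT.indep
    (fun i => (hT.hasLaw i).aemeasurable) s hg]
  refine Finset.prod_congr rfl fun i _ => ?_
  rw [Measure.compProd_apply (hD i)]
  exact (hT.hasLaw i).lintegral_comp (hg i).aemeasurable

lemma hasLaw_gapStep [IsProbabilityMeasure Pr] {W : ℝ≥0 → Ω → ℝ}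
    (hW : IsBrownianReal W Pr) {T : ℕ → Ω → ℝ≥0} {r : ℝ} (hr : 0 < r)
    (hT : IsPoissonArrivals T r Pr)
    (hWT : IndepFun (fun ω (t : ℝ≥0) => W t ω) (fun ω (n : ℕ) => T n ω) Pr) (δ σ : ℝ) (n : ℕ) :
    HasLaw (fun ω => gapStep δ σ (fun u => W u ω) (fun k => T k ω) n)
      (expMeasure r ⊗ₘ stepKernel δ σ) Pr where
  aemeasurable := aemeasurable_gapStep hW hT δ σ n
  map_eq := by
    ext D hD
    rw [Measure.map_apply_of_aemeasurable (aemeasurable_gapStep hW hT δ σ n) hD]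
    simpa using! measure_inter_gapStep hW hr hT hWT δ σ {n} (D := fun _ => D) fun _ => hD

lemma iIndepFun_gapStep [IsProbabilityMeasure Pr] {W : ℝ≥0 → Ω → ℝ}
    (hW : IsBrownianReal W Pr) {T : ℕ → Ω → ℝ≥0} {r : ℝ} (hr : 0 < r)
    (hT : IsPoissonArrivals T r Pr)
    (hWT : IndepFun (fun ω (t : ℝ≥0) => W t ω) (fun ω (n : ℕ) => T n ω) Pr) (δ σ : ℝ) :
    iIndepFun (fun n ω => gapStep δ σ (fun u => W u ω) (fun k => T k ω) n) Pr := by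
  classical
  refine iIndepFun_iff_measure_inter_preimage_eq_mul.2 fun s D hD => ?_
  -- The sets are known to be measurable only for indices in `s`, hence the padding by `univ`.
  let D' : ℕ → Set (ℝ × ℝ) := fun i => if i ∈ s then D i else univ
  have hD' : ∀ i, MeasurableSet (D' i) := fun i => by
    by_cases h : i ∈ s
    · simpa [D', h] using hD i h
    · simp [D', h]
  have h := measure_inter_gapStep hW hr hT hWT δ σ s hD'
  have e : ∀ i ∈ s, D' i = D i := fun i hi => by simp [D', hi]
  have e2 : (⋂ i ∈ s, {ω | gapStep δ σ (fun u => W u ω) (fun k => T k ω) i ∈ D' i}) =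
      ⋂ i ∈ s, (fun ω => gapStep δ σ (fun u => W u ω) (fun k => T k ω) i) ⁻¹' D i :=
    iInter₂_congr fun i hi => by rw [e i hi]; rfl
  rw [e2] at h
  refine h.trans (Finset.prod_congr rfl fun i hi => ?_)
  rw [e i hi]
  exact ((hasLaw_gapStep hW hr hT hWT δ σ i).measure_eq (hD i hi)).symm

end

/-! ### Walks on sequences and their first exit. -/

/-- The walk started at `z` with steps `x 0, x 1, …`. -/
def walk (z : ℝ) (x : ℕ → ℝ) (n : ℕ) : ℝ := z + ∑ i ∈ Finset.range n, x i

/-- The step sequences for which the walk is positive at the times `1, …, n`. -/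
def aliveSet (z : ℝ) (n : ℕ) : Set (ℕ → ℝ) := {x | ∀ k < n, 0 < walk z x (k + 1)}

/-- The index of the step at which the walk first becomes nonpositive. -/
noncomputable def exitIndex (z : ℝ) (x : ℕ → ℝ) : ℕ := sInf {n | walk z x (n + 1) ≤ 0}

/-- A sequence truncated to `0` from index `n` on. -/
def truncSeq (n : ℕ) (x : ℕ → ℝ) (i : ℕ) : ℝ := if i < n then x i else 0

lemma walk_zero (z : ℝ) (x : ℕ → ℝ) : walk z x 0 = z := by simp [walk]

lemma walk_succ (z : ℝ) (x : ℕ → ℝ) (n : ℕ) : walk z x (n + 1) = walk z x n + x n := by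
  simp [walk, Finset.sum_range_succ, add_assoc]

lemma measurable_walk (z : ℝ) (n : ℕ) : Measurable (fun x : ℕ → ℝ => walk z x n) := by
  unfold walk
  fun_prop

lemma measurableSet_aliveSet (z : ℝ) (n : ℕ) : MeasurableSet (aliveSet z n) := by
  have : aliveSet z n = ⋂ k, ⋂ (_ : k < n), {x | 0 < walk z x (k + 1)} := by
    ext x; simp [aliveSet]
  rw [this]
  exact MeasurableSet.iInter fun k => MeasurableSet.iInter fun _ =>
    measurableSet_lt measurable_const (measurable_walk z (k + 1))

lemma walk_truncSeq (z : ℝ) (x : ℕ → ℝ) {k n : ℕ} (h : k ≤ n) :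
    walk z (truncSeq n x) k = walk z x k := by
  unfold walk
  congr 1
  refine Finset.sum_congr rfl fun i hi => ?_
  simp [truncSeq, (Finset.mem_range.1 hi).trans_le h]

lemma truncSeq_mem_aliveSet (z : ℝ) (x : ℕ → ℝ) (n : ℕ) :
    truncSeq n x ∈ aliveSet z n ↔ x ∈ aliveSet z n :=
  forall₂_congr fun k hk => by rw [walk_truncSeq z x (Nat.succ_le_of_lt hk)]

lemma aliveSet_zero (z : ℝ) : aliveSet z 0 = univ := by
  ext x; simp [aliveSet]

lemma mem_aliveSet_succ (z : ℝ) (x : ℕ → ℝ) (n : ℕ) :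
    x ∈ aliveSet z (n + 1) ↔ x ∈ aliveSet z n ∧ 0 < walk z x (n + 1) := by
  simp only [aliveSet, mem_ofPred_eq, Nat.lt_succ_iff_lt_or_eq]
  constructor
  · exact fun h => ⟨fun k hk => h k (Or.inl hk), h n (Or.inr rfl)⟩
  · rintro ⟨h1, h2⟩ k (hk | rfl)
    · exact h1 k hk
    · exact h2

/-- The exit must exist: otherwise `sInf ∅ = 0` although the walk is alive at every time. -/
lemma le_exitIndex_iff {z : ℝ} {x : ℕ → ℝ} (hx : ∃ n, walk z x (n + 1) ≤ 0) (n : ℕ) :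
    n ≤ exitIndex z x ↔ x ∈ aliveSet z n := by
  constructor
  · intro h k hk
    have := Nat.notMem_of_lt_sInf (hk.trans_le h)
    simpa using this
  · intro h
    by_contra hlt
    exact not_lt.2 (Nat.sInf_mem hx : walk z x (exitIndex z x + 1) ≤ 0) (h _ (not_le.1 hlt))

lemma exitIndex_eq_of_mem {z : ℝ} {x : ℕ → ℝ} {n : ℕ} (h1 : x ∈ aliveSet z n)
    (h2 : walk z x (n + 1) ≤ 0) : exitIndex z x = n := by
  refine le_antisymm (Nat.sInf_le h2) ?_
  rwa [le_exitIndex_iff ⟨n, h2⟩]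

section

variable {Ω : Type*}

/-- The outcomes for which the walk is positive at the times `1, …, n`. -/
def alive (z : ℝ) (X : ℕ → Ω → ℝ) (n : ℕ) : Set Ω := {ω | (fun i => X i ω) ∈ aliveSet z n}

lemma alive_zero (z : ℝ) (X : ℕ → Ω → ℝ) : alive z X 0 = univ := by
  simp [alive, aliveSet_zero]

lemma alive_succ (z : ℝ) (X : ℕ → Ω → ℝ) (n : ℕ) :
    alive z X (n + 1) = alive z X n ∩ {ω | 0 < walk z (fun i => X i ω) (n + 1)} := by
  ext ω
  exact mem_aliveSet_succ z _ n

lemma walk_pos_of_mem_alive_succ {z : ℝ} {n : ℕ} {ω : Ω} (hω : ω ∈ alive z X (n + 1)) :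
    0 < walk z (fun i => X i ω) (n + 1) := by
  rw [alive_succ] at hω
  exact hω.2

end

/-! ### The stopped walk: survival, loss at exit, time to exit. -/

/-- The pairs `(E n, X n)` are independent and measurable, `E n` is exponential with rate `r` and
`X n` is the difference of two independent exponentials with rates `a` and `b`. -/
structure IsExpWalk {Ω : Type*} [MeasurableSpace Ω] (Pr : Measure Ω) (a b r : ℝ)
    (E X : ℕ → Ω → ℝ) : Prop where
  measurable_gap : ∀ n, Measurable (E n)
  measurable_step : ∀ n, Measurable (X n)
  indep : iIndepFun (fun n ω => (E n ω, X n ω)) Pr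
  map_gap : ∀ n, Pr.map (E n) = expMeasure r
  map_step : ∀ n, Pr.map (X n) = expDiff a b

namespace IsExpWalk

variable {Ω : Type*} [MeasurableSpace Ω] {Pr : Measure Ω} {a b r : ℝ}
  {E X : ℕ → Ω → ℝ}

/-- Truncation makes the past a function of finitely many pairs. Independence from the whole pair
`n`, gap included, is what the time computation uses. -/
lemma indepFun_truncSeq (h : IsExpWalk Pr a b r E X) (n : ℕ) :
    IndepFun (fun ω => truncSeq n (fun i => X i ω)) (fun ω => (E n ω, X n ω)) Pr := by
  have h1 := h.indep.indepFun_finset (Finset.range n) {n} (by simp)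
    (fun i => (h.measurable_gap i).prodMk (h.measurable_step i))
  have hφ : Measurable (fun (x : Finset.range n → ℝ × ℝ) (i : ℕ) =>
      if hi : i ∈ Finset.range n then (x ⟨i, hi⟩).2 else 0) := by
    refine measurable_pi_iff.2 fun i => ?_
    by_cases hi : i ∈ Finset.range n
    · simp only [hi, dif_pos]
      fun_prop
    · simp only [hi, dif_neg, not_false_iff]
      fun_prop
  have hψ : Measurable (fun x : ({n} : Finset ℕ) → ℝ × ℝ => x ⟨n, by simp⟩) :=
    measurable_pi_apply _
  have h2 := h1.comp hφ hψ
  convert! h2 using 1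
  ext ω i
  simp [truncSeq]

lemma measurable_steps (h : IsExpWalk Pr a b r E X) : Measurable (fun ω i => X i ω) :=
  measurable_pi_iff.2 h.measurable_step

lemma measurable_truncSeq_steps (h : IsExpWalk Pr a b r E X) (n : ℕ) :
    Measurable (fun ω => truncSeq n (fun i => X i ω)) := by
  refine measurable_pi_iff.2 fun i => ?_
  unfold truncSeq
  split_ifs
  · exact h.measurable_step i
  · fun_prop

lemma measurableSet_alive (h : IsExpWalk Pr a b r E X) (z : ℝ) (n : ℕ) :
    MeasurableSet (alive z X n) :=
  h.measurable_steps (measurableSet_aliveSet z n)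

lemma measurableSet_walk_pos (h : IsExpWalk Pr a b r E X) (z : ℝ) (n : ℕ) :
    MeasurableSet {ω | 0 < walk z (fun i => X i ω) n} :=
  measurableSet_lt measurable_const ((measurable_walk z n).comp h.measurable_steps)

/-- Splitting an integral at time `n + 1` according to the sign of the walk. -/
lemma setLIntegral_alive_split (h : IsExpWalk Pr a b r E X) (z : ℝ) (n : ℕ) (F : Ω → ℝ≥0∞) :
    ∫⁻ ω in alive z X n, F ω ∂Pr =
      (∫⁻ ω in alive z X (n + 1), F ω ∂Pr) +
        ∫⁻ ω in alive z X n \ {ω | 0 < walk z (fun i => X i ω) (n + 1)}, F ω ∂Pr := by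
  rw [alive_succ, lintegral_inter_add_sdiff _ _ (h.measurableSet_walk_pos z (n + 1))]

variable [IsProbabilityMeasure Pr]

/-- Markov property at time `n`: survival and position depend on the past only, so the fresh pair
can be integrated out. The map `ψ` selects its gap or its step. -/
lemma setLIntegral_alive (h : IsExpWalk Pr a b r E X) (z : ℝ) (n : ℕ) {β : Type*}
    [MeasurableSpace β] {ψ : ℝ × ℝ → β} (hψ : Measurable ψ) {f : ℝ → β → ℝ≥0∞}
    (hf : Measurable (fun p : ℝ × β => f p.1 p.2)) :
    ∫⁻ ω in alive z X n, f (walk z (fun i => X i ω) n) (ψ (E n ω, X n ω)) ∂Pr =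
      ∫⁻ ω in alive z X n, ∫⁻ y, f (walk z (fun i => X i ω) n) y
        ∂(Pr.map fun ω => ψ (E n ω, X n ω)) ∂Pr := by
  have hm : Measurable (fun ω => ψ (E n ω, X n ω)) :=
    hψ.comp ((h.measurable_gap n).prodMk (h.measurable_step n))
  have hind := (h.indepFun_truncSeq n).comp (φ := id) measurable_id hψ
  let F : (ℕ → ℝ) × β → ℝ≥0∞ := fun p =>
    (aliveSet z n).indicator (fun x => f (walk z x n) p.2) p.1
  have hF : Measurable F := by
    have h1 : F = (Prod.fst ⁻¹' aliveSet z n).indicator (fun p => f (walk z p.1 n) p.2) := by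
      ext p
      by_cases hp : p.1 ∈ aliveSet z n <;> simp [F, hp]
    rw [h1]
    refine Measurable.indicator ?_ (measurable_fst (measurableSet_aliveSet z n))
    exact hf.comp (((measurable_walk z n).comp measurable_fst).prodMk measurable_snd)
  have e1 : ∀ ω y, F (truncSeq n (fun i => X i ω), y) =
      (alive z X n).indicator (fun ω => f (walk z (fun i => X i ω) n) y) ω := fun ω y => by
    have e : ω ∈ alive z X n ↔ (fun i => X i ω) ∈ aliveSet z n := Iff.rfl
    by_cases hω : (fun i => X i ω) ∈ aliveSet z n <;>
      simp [F, e, hω, truncSeq_mem_aliveSet, walk_truncSeq z _ le_rfl]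
  have hprob : IsProbabilityMeasure (Pr.map fun ω => ψ (E n ω, X n ω)) :=
    Measure.isProbabilityMeasure_map hm.aemeasurable
  rw [← lintegral_indicator (h.measurableSet_alive z n),
    ← lintegral_indicator (h.measurableSet_alive z n)]
  calc _ = ∫⁻ ω, F (truncSeq n (fun i => X i ω), ψ (E n ω, X n ω)) ∂Pr :=
        lintegral_congr fun ω => by rw [e1]; rfl
    _ = ∫⁻ p, F p ∂(Pr.map fun ω => (truncSeq n (fun i => X i ω), ψ (E n ω, X n ω))) :=
        (lintegral_map hF ((h.measurable_truncSeq_steps n).prodMk hm)).symm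
    _ = ∫⁻ p, F p ∂((Pr.map fun ω => truncSeq n (fun i => X i ω)).prod
          (Pr.map fun ω => ψ (E n ω, X n ω))) := by
        rw [← (indepFun_iff_map_prod_eq_prod_map_map
          (h.measurable_truncSeq_steps n).aemeasurable hm.aemeasurable).1 hind]
    _ = ∫⁻ ω, ∫⁻ y, F (truncSeq n (fun i => X i ω), y)
          ∂(Pr.map fun ω => ψ (E n ω, X n ω)) ∂Pr := by
        rw [lintegral_prod _ hF.aemeasurable,
          lintegral_map hF.lintegral_prod_right' (h.measurable_truncSeq_steps n)]
    _ = _ := lintegral_congr fun ω => by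
        simp_rw [e1]
        by_cases hω : ω ∈ alive z X n <;> simp [hω]

lemma setLIntegral_alive_walk_succ (h : IsExpWalk Pr a b r E X) (hb : 0 < b) (z : ℝ) (n : ℕ)
    {f : ℝ → ℝ≥0∞} (hf : Measurable f) :
    ∫⁻ ω in alive z X n, f (walk z (fun i => X i ω) (n + 1)) ∂Pr =
      ∫⁻ ω in alive z X n, ∫⁻ u, ∫⁻ v, f (walk z (fun i => X i ω) n + (u - v))
        ∂expMeasure b ∂expMeasure a ∂Pr := by
  simp_rw [walk_succ]
  refine (h.setLIntegral_alive z n (ψ := Prod.snd) measurable_snd (f := fun y x => f (y + x))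
    (hf.comp (by fun_prop))).trans (lintegral_congr fun ω => ?_)
  change ∫⁻ y, f (walk z (fun i => X i ω) n + y) ∂(Pr.map (X n)) = _
  rw [h.map_step, lintegral_expDiff hb
    (f := fun y => f (walk z (fun i => X i ω) n + y)) (hf.comp (by fun_prop))]

lemma setLIntegral_alive_gap (h : IsExpWalk Pr a b r E X) (hr : 0 < r) (z : ℝ) (n : ℕ) :
    ∫⁻ ω in alive z X n, ENNReal.ofReal (E n ω) ∂Pr =
      ENNReal.ofReal (1 / r) * Pr (alive z X n) := by
  refine (h.setLIntegral_alive z n (ψ := Prod.fst) measurable_fst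
    (f := fun _ x => ENNReal.ofReal x) (by fun_prop)).trans ?_
  have e : ∫⁻ y, ENNReal.ofReal y ∂(Pr.map (E n)) = ENNReal.ofReal (1 / r) := by
    rw [h.map_gap]
    simpa using lintegral_ofReal_add_of_nonneg hr (le_refl 0)
  calc _ = ∫⁻ ω in alive z X n, ENNReal.ofReal (1 / r) ∂Pr := by rw [← e]
    _ = _ := by simp

/-- The step has exponential moment `ab / ((a - θ)(b + θ))`, smallest at `θ = (a - b) / 2`, where
both factors of the denominator are `(a + b) / 2`. The ratio `4ab / (a + b)²` is below `1` because
`a ≠ b`. -/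
lemma setLIntegral_exp_le (h : IsExpWalk Pr a b r E X) (ha : 0 < a) (hb : 0 < b) (hba : b < a)
    (z : ℝ) (n : ℕ) :
    ∫⁻ ω in alive z X n,
        ENNReal.ofReal (Real.exp ((a - b) / 2 * walk z (fun i => X i ω) n)) ∂Pr ≤
      ENNReal.ofReal (4 * a * b / (a + b) ^ 2) ^ n *
        ENNReal.ofReal (Real.exp ((a - b) / 2 * z)) := by
  induction n with
  | zero => simp [alive_zero, walk_zero]
  | succ n ih =>
    have hK : ∀ y : ℝ, ∫⁻ u, ∫⁻ v, ENNReal.ofReal (Real.exp ((a - b) / 2 * (y + (u - v))))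
        ∂expMeasure b ∂expMeasure a = ENNReal.ofReal (4 * a * b / (a + b) ^ 2) *
          ENNReal.ofReal (Real.exp ((a - b) / 2 * y)) := fun y => by
      have e : ∀ u v : ℝ, ENNReal.ofReal (Real.exp ((a - b) / 2 * (y + (u - v)))) =
          ENNReal.ofReal (Real.exp ((a - b) / 2 * y)) *
            (ENNReal.ofReal (Real.exp ((a - b) / 2 * u)) *
              ENNReal.ofReal (Real.exp (-((a - b) / 2) * v))) := fun u v => by
        rw [← ENNReal.ofReal_mul (by positivity), ← ENNReal.ofReal_mul (by positivity),
          ← Real.exp_add, ← Real.exp_add]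
        ring_nf
      simp_rw [e]
      have e2 : ∀ u : ℝ, ∫⁻ v, ENNReal.ofReal (Real.exp ((a - b) / 2 * y)) *
            (ENNReal.ofReal (Real.exp ((a - b) / 2 * u)) *
              ENNReal.ofReal (Real.exp (-((a - b) / 2) * v))) ∂expMeasure b =
          ENNReal.ofReal (Real.exp ((a - b) / 2 * y)) * ENNReal.ofReal (b / (b + (a - b) / 2)) *
            ENNReal.ofReal (Real.exp ((a - b) / 2 * u)) := fun u => by
        rw [lintegral_const_mul _ (by fun_prop), lintegral_const_mul _ (by fun_prop),
          lintegral_exp_mul_expMeasure hb (by linarith), sub_neg_eq_add]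
        ring
      simp_rw [e2]
      rw [lintegral_const_mul _ (by fun_prop), lintegral_exp_mul_expMeasure ha (by linarith),
        mul_assoc, ← ENNReal.ofReal_mul (by apply div_nonneg <;> linarith), mul_comm]
      congr 2
      have h1 : b + (a - b) / 2 = (a + b) / 2 := by ring
      have h2 : a - (a - b) / 2 = (a + b) / 2 := by ring
      rw [h1, h2]
      field_simp
      ring
    calc _ ≤ ∫⁻ ω in alive z X n,
          ENNReal.ofReal (Real.exp ((a - b) / 2 * walk z (fun i => X i ω) (n + 1))) ∂Pr :=
          lintegral_mono_set (by rw [alive_succ]; exact inter_subset_left)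
      _ = ENNReal.ofReal (4 * a * b / (a + b) ^ 2) * ∫⁻ ω in alive z X n,
          ENNReal.ofReal (Real.exp ((a - b) / 2 * walk z (fun i => X i ω) n)) ∂Pr := by
          rw [h.setLIntegral_alive_walk_succ hb z n
            (f := fun y => ENNReal.ofReal (Real.exp ((a - b) / 2 * y))) (by fun_prop)]
          simp_rw [hK]
          rw [lintegral_const_mul' _ _ ENNReal.ofReal_ne_top]
      _ ≤ _ := by
          rw [pow_succ' (ENNReal.ofReal (4 * a * b / (a + b) ^ 2)), mul_assoc (ENNReal.ofReal _)]
          exact mul_le_mul_right ih _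

lemma tendsto_setLIntegral_exp (h : IsExpWalk Pr a b r E X) (ha : 0 < a) (hb : 0 < b)
    (hba : b < a) (z : ℝ) :
    Tendsto (fun n => ∫⁻ ω in alive z X n,
        ENNReal.ofReal (Real.exp ((a - b) / 2 * walk z (fun i => X i ω) n)) ∂Pr) atTop (𝓝 0) := by
  have hρ : ENNReal.ofReal (4 * a * b / (a + b) ^ 2) < 1 := by
    rw [ENNReal.ofReal_lt_one, div_lt_one (by positivity)]
    nlinarith [sq_pos_of_pos (sub_pos.2 hba)]
  have h1 := ENNReal.Tendsto.mul_const (b := ENNReal.ofReal (Real.exp ((a - b) / 2 * z)))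
    (ENNReal.tendsto_pow_atTop_nhds_zero_of_lt_one hρ) (Or.inr ENNReal.ofReal_ne_top)
  rw [zero_mul] at h1
  exact tendsto_of_tendsto_of_tendsto_of_le_of_le tendsto_const_nhds h1 (fun _ => zero_le)
    (fun n => h.setLIntegral_exp_le ha hb hba z n)

lemma tendsto_measure_alive (h : IsExpWalk Pr a b r E X) (ha : 0 < a) (hb : 0 < b)
    (hba : b < a) (z : ℝ) : Tendsto (fun n => Pr (alive z X n)) atTop (𝓝 0) := by
  -- Index `0` is skipped: positivity of the walk is only known on `alive z X (n + 1)`, since `z`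
  -- itself may be negative.
  rw [← tendsto_add_atTop_iff_nat 1]
  refine tendsto_of_tendsto_of_tendsto_of_le_of_le tendsto_const_nhds
    ((tendsto_add_atTop_iff_nat 1).2 (h.tendsto_setLIntegral_exp ha hb hba z))
    (fun _ => zero_le) fun n => ?_
  change Pr (alive z X (n + 1)) ≤ ∫⁻ ω in alive z X (n + 1),
    ENNReal.ofReal (Real.exp ((a - b) / 2 * walk z (fun i => X i ω) (n + 1))) ∂Pr
  rw [← setLIntegral_one]
  refine setLIntegral_mono' (h.measurableSet_alive z _) fun ω hω => ?_
  rw [← ENNReal.ofReal_one]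
  refine ENNReal.ofReal_le_ofReal (Real.one_le_exp ?_)
  have := walk_pos_of_mem_alive_succ hω
  have : 0 < (a - b) / 2 := by linarith
  positivity

lemma ae_exists_walk_nonpos (h : IsExpWalk Pr a b r E X) (ha : 0 < a) (hb : 0 < b)
    (hba : b < a) (z : ℝ) : ∀ᵐ ω ∂Pr, ∃ n, walk z (fun i => X i ω) (n + 1) ≤ 0 := by
  rw [ae_iff]
  refine le_antisymm (ge_of_tendsto' (h.tendsto_measure_alive ha hb hba z) fun n => ?_) zero_le
  refine measure_mono fun ω hω => ?_
  simp only [mem_ofPred_eq, not_exists, not_le] at hω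
  exact fun k _ => hω k

/-- From time `1` on, the extended loss profile along the stopped walk keeps a constant expectation,
equal to its one-step value. The still-alive part has mass tending to `0`, so in the limit only the
loss realised at exit remains. -/
lemma lintegral_loss (h : IsExpWalk Pr a b r E X) (ha : 0 < a) (hb : 0 < b) (hba : b < a)
    (z : ℝ) :
    ∫⁻ ω, ENNReal.ofReal (1 - Real.exp (walk z (fun i => X i ω)
        (exitIndex z (fun i => X i ω) + 1))) ∂Pr =
      ∫⁻ u, ∫⁻ v, ENNReal.ofReal (lossProfile (1 / (1 + b)) (z + (u - v)))
        ∂expMeasure b ∂expMeasure a := by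
  set c : ℝ := 1 / (1 + b) with hc
  set f : ℝ → ℝ≥0∞ := fun y => ENNReal.ofReal (lossProfile c y) with hf
  have hfm : Measurable f := (measurable_lossProfile c).ennreal_ofReal
  set C : ℕ → Set Ω := fun n => alive z X n \ {ω | 0 < walk z (fun i => X i ω) (n + 1)} with hC
  have hCm : ∀ n, MeasurableSet (C n) := fun n =>
    (h.measurableSet_alive z n).diff (h.measurableSet_walk_pos z (n + 1))
  -- The loss collected on `C n`, the event that the exit happens at step `n`.
  set L : ℕ → ℝ≥0∞ := fun n => ∫⁻ ω in C n, f (walk z (fun i => X i ω) (n + 1)) ∂Pr with hL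
  have hsplit : ∀ n, ∫⁻ ω in alive z X n, f (walk z (fun i => X i ω) (n + 1)) ∂Pr =
      ENNReal.ofReal c * Pr (alive z X (n + 1)) + L n := fun n => by
    rw [h.setLIntegral_alive_split]
    congr 1
    rw [← setLIntegral_const]
    refine setLIntegral_congr_fun (h.measurableSet_alive z _) fun ω hω => ?_
    have := walk_pos_of_mem_alive_succ hω
    simp [hf, lossProfile, not_le.2 this]
  have hstep : ∀ n, ∫⁻ ω in alive z X (n + 1), f (walk z (fun i => X i ω) (n + 2)) ∂Pr =
      ENNReal.ofReal c * Pr (alive z X (n + 1)) := fun n => by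
    rw [h.setLIntegral_alive_walk_succ hb z (n + 1) hfm, ← setLIntegral_const]
    refine setLIntegral_congr_fun (h.measurableSet_alive z _) fun ω hω => ?_
    exact lintegral_lossProfile_sub_of_nonneg ha hb (walk_pos_of_mem_alive_succ hω).le
  have hpart : ∀ m, (∑ n ∈ Finset.range (m + 1), L n) +
      ENNReal.ofReal c * Pr (alive z X (m + 1)) =
      ∫⁻ u, ∫⁻ v, f (z + (u - v)) ∂expMeasure b ∂expMeasure a := fun m => by
    induction m with
    | zero =>
      have h0 := h.setLIntegral_alive_walk_succ hb z 0 hfm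
      rw [hsplit 0] at h0
      simp only [alive_zero, Measure.restrict_univ, walk_zero, lintegral_const, measure_univ,
        mul_one] at h0
      rw [Finset.sum_range_one, add_comm, ← h0]
    | succ m ih =>
      rw [Finset.sum_range_succ, add_assoc, add_comm (L (m + 1)), ← hsplit (m + 1), hstep m, ih]
  have hlim : Tendsto (fun m => (∑ n ∈ Finset.range (m + 1), L n) +
      ENNReal.ofReal c * Pr (alive z X (m + 1))) atTop (𝓝 (∑' n, L n + ENNReal.ofReal c * 0)) :=
    ((tendsto_add_atTop_iff_nat 1).2 (ENNReal.tendsto_nat_tsum L)).add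
      (ENNReal.Tendsto.const_mul
        ((tendsto_add_atTop_iff_nat 1).2 (h.tendsto_measure_alive ha hb hba z))
        (Or.inr ENNReal.ofReal_ne_top))
  simp_rw [hpart, mul_zero, add_zero] at hlim
  rw [tendsto_nhds_unique tendsto_const_nhds hlim]
  have hmem : ∀ n ω, ω ∈ C n → exitIndex z (fun i => X i ω) = n := fun n ω hω =>
    exitIndex_eq_of_mem hω.1 (not_lt.1 hω.2)
  have hdisj : Pairwise (Function.onFun Disjoint C) := fun m n hmn =>
    Set.disjoint_left.2 fun ω hm hn => hmn ((hmem m ω hm).symm.trans (hmem n ω hn))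
  have huniv : (⋃ n, C n) =ᵐ[Pr] univ := by
    refine eventuallyEq_univ.2 ?_
    filter_upwards [h.ae_exists_walk_nonpos ha hb hba z] with ω hω
    refine mem_iUnion.2 ⟨exitIndex z (fun i => X i ω), (le_exitIndex_iff hω _).1 le_rfl, ?_⟩
    have hle : walk z (fun i => X i ω) (exitIndex z (fun i => X i ω) + 1) ≤ 0 := Nat.sInf_mem hω
    exact not_lt.2 hle
  rw [← setLIntegral_univ, ← setLIntegral_congr huniv, lintegral_iUnion hCm hdisj]
  refine tsum_congr fun n => setLIntegral_congr_fun (hCm n) fun ω hω => ?_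
  have h1 : walk z (fun i => X i ω) (n + 1) ≤ 0 := not_lt.1 hω.2
  simp only [hmem n ω hω, hf, lossProfile, h1, if_true]

/-- The factor `1/b - 1/a` is the mean drop of one step. It is kept as a multiplier so that the
identity in `ℝ≥0∞` needs neither division nor prior finiteness. -/
lemma lintegral_exit_time (h : IsExpWalk Pr a b r E X) (ha : 0 < a) (hb : 0 < b) (hba : b < a)
    (hr : 0 < r) (z : ℝ) :
    ENNReal.ofReal (1 / b - 1 / a) * ∫⁻ ω, ∑ k ∈ Finset.range (exitIndex z (fun i => X i ω) + 1),
        ENNReal.ofReal (E k ω) ∂Pr =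
      ENNReal.ofReal (1 / r) * (ENNReal.ofReal (1 / b - 1 / a) +
        ∫⁻ u, ENNReal.ofReal (z + u) ∂expMeasure a) := by
  set q : ℝ≥0∞ := ENNReal.ofReal (1 / b - 1 / a) with hq
  have hq0 : 0 ≤ 1 / b - 1 / a := sub_nonneg.2 (one_div_le_one_div_of_le hb hba.le)
  set f : ℝ → ℝ≥0∞ := fun y => ENNReal.ofReal (heightProfile b y) with hf
  have hfm : Measurable f := (measurable_heightProfile b).ennreal_ofReal
  set U : ℕ → ℝ≥0∞ := fun n =>
    ∫⁻ ω in alive z X n, f (walk z (fun i => X i ω) (n + 1)) ∂Pr with hU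
  have hK : ∀ y, ∫⁻ u, ∫⁻ v, f (y + (u - v)) ∂expMeasure b ∂expMeasure a =
      ∫⁻ u, ENNReal.ofReal (y + u) ∂expMeasure a := fun y => lintegral_congr fun u => by
    simp only [← add_sub_assoc]
    exact lintegral_heightProfile hb (y + u)
  have hdrop : ∀ n, U n =
      ∫⁻ ω in alive z X (n + 1), f (walk z (fun i => X i ω) (n + 1)) ∂Pr := fun n => by
    rw [hU]
    simp only
    rw [h.setLIntegral_alive_split]
    convert add_zero _
    rw [setLIntegral_congr_fun (g := fun _ => 0) ((h.measurableSet_alive z n).diff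
      (h.measurableSet_walk_pos z (n + 1))), lintegral_zero]
    intro ω hω
    have : ¬ 0 < walk z (fun i => X i ω) (n + 1) := hω.2
    simp [hf, heightProfile, this]
  -- From `y > 0` one step takes the mean height from `y + 1/b` to `y + 1/a`, a loss of exactly `q`.
  have hstep : ∀ n, U n = U (n + 1) + q * Pr (alive z X (n + 1)) := fun n => by
    rw [hdrop n]
    simp only [hU]
    rw [h.setLIntegral_alive_walk_succ hb z (n + 1) hfm, ← setLIntegral_const,
      ← lintegral_add_right _ measurable_const]
    refine setLIntegral_congr_fun (h.measurableSet_alive z _) fun ω hω => ?_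
    have hpos := walk_pos_of_mem_alive_succ hω
    simp only [hK]
    rw [lintegral_ofReal_add_of_nonneg ha hpos.le, hq, ← ENNReal.ofReal_add (by positivity) hq0]
    simp only [hf, heightProfile, hpos, if_true]
    congr 1
    ring
  have hpart : ∀ m, U 0 = U m + q * ∑ n ∈ Finset.range m, Pr (alive z X (n + 1)) := fun m => by
    induction m with
    | zero => simp
    | succ m ih => rw [ih, hstep m, Finset.sum_range_succ, mul_add]; ring
  -- The height is unbounded, so vanishing survival probability is not enough; it is dominated by
  -- the exponential whose integral decays geometrically.
  have hUlim : Tendsto U atTop (𝓝 0) := by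
    set θ : ℝ := (a - b) / 2 with hθ
    have hθ0 : 0 < θ := by rw [hθ]; linarith
    have h1 := ENNReal.Tendsto.const_mul (a := ENNReal.ofReal (1 / θ + 1 / b))
      ((tendsto_add_atTop_iff_nat 1).2 (h.tendsto_setLIntegral_exp ha hb hba z))
      (Or.inr ENNReal.ofReal_ne_top)
    rw [mul_zero] at h1
    refine tendsto_of_tendsto_of_tendsto_of_le_of_le tendsto_const_nhds h1 (fun _ => zero_le)
      fun n => ?_
    rw [hdrop n]
    simp only
    rw [← lintegral_const_mul' _ _ ENNReal.ofReal_ne_top]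
    refine setLIntegral_mono' (h.measurableSet_alive z _) fun ω hω => ?_
    have hpos := walk_pos_of_mem_alive_succ hω
    rw [← ENNReal.ofReal_mul (by positivity)]
    simp only [hf, heightProfile, hpos, if_true]
    refine ENNReal.ofReal_le_ofReal ?_
    set y := walk z (fun i => X i ω) (n + 1)
    have h2 : θ * y + 1 ≤ Real.exp (θ * y) := Real.add_one_le_exp _
    have h3 : y = 1 / θ * (θ * y) := by field_simp
    have h4 : 0 < θ * y := by positivity
    have h5 : 0 < 1 / θ := by positivity
    have h6 : 0 < 1 / b := by positivity
    calc y + 1 / b = 1 / θ * (θ * y) + 1 / b * 1 := by rw [← h3, mul_one]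
      _ ≤ 1 / θ * Real.exp (θ * y) + 1 / b * Real.exp (θ * y) :=
          add_le_add (mul_le_mul_of_nonneg_left (by linarith) h5.le)
            (mul_le_mul_of_nonneg_left (by linarith) h6.le)
      _ = _ := by ring
  have hsum : U 0 = q * ∑' n, Pr (alive z X (n + 1)) := by
    have h1 := hUlim.add (ENNReal.Tendsto.const_mul (a := q)
      (ENNReal.tendsto_nat_tsum fun n => Pr (alive z X (n + 1))) (Or.inr ENNReal.ofReal_ne_top))
    rw [zero_add] at h1
    exact tendsto_nhds_unique (tendsto_const_nhds.congr hpart) h1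
  have hU0 : U 0 = ∫⁻ u, ENNReal.ofReal (z + u) ∂expMeasure a := by
    have h0 := h.setLIntegral_alive_walk_succ hb z 0 hfm
    simp only [hK] at h0
    simpa [hU, alive_zero, walk_zero] using h0
  -- Wald: gap `k` is counted exactly when the walk is alive at time `k`, an event independent of
  -- that gap.
  have htime : ∫⁻ ω, ∑ k ∈ Finset.range (exitIndex z (fun i => X i ω) + 1),
      ENNReal.ofReal (E k ω) ∂Pr = ∑' k, ENNReal.ofReal (1 / r) * Pr (alive z X k) := by
    simp_rw [← h.setLIntegral_alive_gap hr z, ← lintegral_indicator (h.measurableSet_alive z _)]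
    rw [← lintegral_tsum fun k =>
      (((h.measurable_gap k).ennreal_ofReal).indicator (h.measurableSet_alive z k)).aemeasurable]
    refine lintegral_congr_ae ?_
    filter_upwards [h.ae_exists_walk_nonpos ha hb hba z] with ω hω
    rw [tsum_eq_sum (s := Finset.range (exitIndex z (fun i => X i ω) + 1))]
    · refine Finset.sum_congr rfl fun k hk => ?_
      have : ω ∈ alive z X k :=
        (le_exitIndex_iff hω k).1 (Nat.lt_succ_iff.1 (Finset.mem_range.1 hk))
      simp [this]
    · intro k hk
      have : ω ∉ alive z X k := fun hmem => hk (Finset.mem_range.2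
        (Nat.lt_succ_of_le ((le_exitIndex_iff hω k).2 hmem)))
      simp [this]
  rw [htime, ENNReal.tsum_mul_left, tsum_eq_zero_add' ENNReal.summable, alive_zero, measure_univ,
    ← hU0, hsum]
  ring

end IsExpWalk

/-! ### Truncated Gaussian integrals. -/

section GaussianIntegrals

lemma gaussianReal_real_Iic_zero (m : ℝ) {s : ℝ} (hs : 0 < s) :
    (gaussianReal m (Real.toNNReal (s ^ 2))).real (Iic 0) = Φ (-(m / s)) := by
  have h1 : gaussianReal m (Real.toNNReal (s ^ 2)) =
      (gaussianReal 0 1).map (fun x => s * x + m) := by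
    have h2 : (fun x => s * x + m) = (fun x => x + m) ∘ (fun x => s * x) := rfl
    rw [h2, ← Measure.map_map (by fun_prop) (by fun_prop), gaussianReal_map_const_mul,
      gaussianReal_map_add_const]
    congr 1
    · simp
    · ext
      simp [Real.coe_toNNReal _ (sq_nonneg s)]
  rw [h1, map_measureReal_apply (by fun_prop) measurableSet_Iic, Φ, cdf_eq_real]
  congr 1
  ext x
  simp only [mem_preimage, mem_Iic]
  rw [← neg_div, le_div_iff₀ hs]
  constructor <;> intro h <;> linarith

lemma gaussianReal_real_Ioi_zero (m : ℝ) {s : ℝ} (hs : 0 < s) :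
    (gaussianReal m (Real.toNNReal (s ^ 2))).real (Ioi 0) = Φ (m / s) := by
  have hv : Real.toNNReal (s ^ 2) ≠ 0 := by simpa using hs.ne'
  have := nullSingletonClass_gaussianReal (μ := m) hv
  have h1 := gaussianReal_real_Iic_zero (-m) hs
  rw [neg_div, neg_neg] at h1
  rw [← h1, ← gaussianReal_map_neg, map_measureReal_apply (by fun_prop) measurableSet_Iic,
    measureReal_congr Ioi_ae_eq_Ici]
  congr 1
  ext x
  simp

/-- Completing the square: an exponential tilt of a Gaussian density is a mean shift by `α s²`, up
to a constant. -/
lemma gaussianPDFReal_mul_exp (m α x : ℝ) {s : ℝ} (hs : 0 < s) :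
    gaussianPDFReal m (Real.toNNReal (s ^ 2)) x * Real.exp (α * x) =
      Real.exp (α * m + α ^ 2 * s ^ 2 / 2) *
        gaussianPDFReal (m + α * s ^ 2) (Real.toNNReal (s ^ 2)) x := by
  simp only [gaussianPDFReal, Real.coe_toNNReal _ (sq_nonneg s)]
  rw [mul_assoc, ← Real.exp_add, mul_left_comm, ← Real.exp_add]
  congr 2
  field_simp
  ring

lemma setIntegral_exp_gaussianReal (m α : ℝ) {s : ℝ} (hs : 0 < s) :
    ∫ x in Iic 0, Real.exp (α * x) ∂gaussianReal m (Real.toNNReal (s ^ 2)) =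
      Real.exp (α * m + α ^ 2 * s ^ 2 / 2) * Φ (-(m / s) - α * s) := by
  have hv : Real.toNNReal (s ^ 2) ≠ 0 := by simpa using hs.ne'
  have h0 : -(m / s) - α * s = -((m + α * s ^ 2) / s) := by field_simp; ring
  rw [h0, ← gaussianReal_real_Iic_zero _ hs, ← integral_indicator_one measurableSet_Iic,
    ← integral_indicator measurableSet_Iic, integral_gaussianReal_eq_integral_smul hv,
    integral_gaussianReal_eq_integral_smul hv, ← integral_const_mul]
  refine integral_congr_ae (ae_of_all _ fun x => ?_)
  by_cases hx : x ∈ Iic (0 : ℝ)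
  · simp [indicator_of_mem hx, gaussianPDFReal_mul_exp m α x hs]
  · simp [indicator_of_notMem hx]

/-- Split `x = (x - m) + m`; the density times `x - m` is the derivative of `-s²` times the density,
which yields the boundary term at `0`. -/
lemma setIntegral_id_gaussianReal (m : ℝ) {s : ℝ} (hs : 0 < s) :
    ∫ x in Ioi 0, x ∂gaussianReal m (Real.toNNReal (s ^ 2)) =
      m * Φ (m / s) + s / √(2 * Real.pi) * Real.exp (-(m ^ 2 / (2 * s ^ 2))) := by
  have hv : Real.toNNReal (s ^ 2) ≠ 0 := by simpa using hs.ne'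
  set v := Real.toNNReal (s ^ 2) with hvdef
  have hvs : (v : ℝ) = s ^ 2 := Real.coe_toNNReal _ (sq_nonneg s)
  have hid : Integrable (fun x : ℝ => x) (gaussianReal m v) :=
    memLp_one_iff_integrable.1 (memLp_id_gaussianReal' 1 (by simp))
  have hint : Integrable (fun x => gaussianPDFReal m v x * (x - m)) := by
    have h1 : Integrable (fun x : ℝ => x - m) (gaussianReal m v) := hid.sub (integrable_const m)
    rw [gaussianReal_of_var_ne_zero m hv, integrable_withDensity_iff_integrable_smul'
      (measurable_gaussianPDF m v) (ae_of_all _ fun _ => gaussianPDF_lt_top)] at h1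
    simpa [toReal_gaussianPDF] using h1
  have hder : ∀ x ∈ Ici (0 : ℝ), HasDerivAt (fun x => -s ^ 2 * gaussianPDFReal m v x)
      (gaussianPDFReal m v x * (x - m)) x := fun x _ => by
    unfold gaussianPDFReal
    have h1 : HasDerivAt (fun x : ℝ => -(x - m) ^ 2 / (2 * v)) (-(x - m) / s ^ 2) x := by
      refine ((((hasDerivAt_id x).sub_const m).pow 2).neg.div_const (2 * (v : ℝ))).congr_deriv ?_
      rw [hvs]
      simp
      field_simp
      ring
    refine ((h1.exp.const_mul (√(2 * Real.pi * v))⁻¹).const_mul (-s ^ 2)).congr_deriv ?_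
    field_simp
  have hlim : Tendsto (fun x => -s ^ 2 * gaussianPDFReal m v x) atTop (𝓝 0) := by
    unfold gaussianPDFReal
    have h1 : Tendsto (fun x : ℝ => -(x - m) ^ 2 / (2 * v)) atTop atBot := by
      have h2 : Tendsto (fun x : ℝ => (x - m) ^ 2 / (2 * v)) atTop atTop :=
        ((tendsto_pow_atTop two_ne_zero).comp (tendsto_atTop_add_const_right _ (-m) tendsto_id)
          ).atTop_div_const (by rw [hvs]; positivity)
      refine (tendsto_neg_atTop_atBot.comp h2).congr fun x => ?_
      simp [neg_div]
    have h3 := ((Real.tendsto_exp_atBot.comp h1).const_mul (√(2 * Real.pi * v))⁻¹).const_mul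
      (-s ^ 2)
    simpa using h3
  have h2 : ∫ x in Ioi 0, (x - m) ∂gaussianReal m v = s ^ 2 * gaussianPDFReal m v 0 := by
    rw [← integral_indicator measurableSet_Ioi, integral_gaussianReal_eq_integral_smul hv]
    have h3 : (fun x => gaussianPDFReal m v x • (Ioi (0 : ℝ)).indicator (fun x => x - m) x) =
        (Ioi (0 : ℝ)).indicator (fun x => gaussianPDFReal m v x * (x - m)) := by
      ext x
      by_cases hx : x ∈ Ioi (0 : ℝ) <;> simp [indicator, hx]
    rw [h3, integral_indicator measurableSet_Ioi,
      integral_Ioi_of_hasDerivAt_of_tendsto' hder hint.integrableOn hlim]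
    ring
  rw [integral_sub hid.integrableOn (integrable_const m).integrableOn, setIntegral_const,
    hvdef, gaussianReal_real_Ioi_zero m hs, ← hvdef, smul_eq_mul] at h2
  have h4 : s ^ 2 * gaussianPDFReal m v 0 =
      s / √(2 * Real.pi) * Real.exp (-(m ^ 2 / (2 * s ^ 2))) := by
    rw [gaussianPDFReal, hvs, Real.sqrt_mul (by positivity), Real.sqrt_sq hs.le]
    have h5 : -(0 - m) ^ 2 / (2 * s ^ 2) = -(m ^ 2 / (2 * s ^ 2)) := by ring
    rw [h5]
    field_simp
  linarith

end GaussianIntegrals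

/-! ### Averaging the value functions over a Gaussian start. -/

/-- The mean of the positive part of `z + U` for an exponential `U` with rate `a`. -/
noncomputable def fillValue (a z : ℝ) : ℝ := if z ≤ 0 then Real.exp (a * z) / a else z + 1 / a

lemma fillValue_nonneg {a : ℝ} (ha : 0 < a) (z : ℝ) : 0 ≤ fillValue a z := by
  unfold fillValue
  split_ifs with h
  · positivity
  · have : 0 < z := not_le.1 h
    positivity

lemma lintegral_ofReal_add {a : ℝ} (ha : 0 < a) (z : ℝ) :
    ∫⁻ u, ENNReal.ofReal (z + u) ∂expMeasure a = ENNReal.ofReal (fillValue a z) := by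
  unfold fillValue
  split_ifs with h
  · exact lintegral_ofReal_add_of_nonpos ha h
  · exact lintegral_ofReal_add_of_nonneg ha (not_le.1 h).le

lemma integrable_lossValue (a b m : ℝ) (v : ℝ≥0) :
    Integrable (lossValue a b) (gaussianReal m v) := by
  have h : lossValue a b = (Iic (0 : ℝ)).piecewise (fun z =>
      1 - b / (b + 1) * a / (a - 1) * Real.exp z
        + (b / (b + 1) * a / (a - 1) - b / (b + 1)) * Real.exp (a * z))
      (fun _ => 1 / (1 + b)) := by
    ext z
    simp [lossValue, piecewise]
  have h1 : Integrable (fun z => Real.exp z) (gaussianReal m v) := by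
    simpa using integrable_exp_mul_gaussianReal (μ := m) (v := v) 1
  rw [h]
  exact Integrable.piecewise measurableSet_Iic
    ((((integrable_const 1).sub (h1.const_mul _)).add
      ((integrable_exp_mul_gaussianReal a).const_mul _)).integrableOn)
    (integrable_const _).integrableOn

lemma integral_lossValue (a b m : ℝ) {s : ℝ} (hs : 0 < s) :
    ∫ z, lossValue a b z ∂gaussianReal m (Real.toNNReal (s ^ 2)) =
      1 / (1 + b) + (1 - 1 / (1 + b)) * Φ (-(m / s))
        - b / (b + 1) * a / (a - 1) * (Real.exp (m + s ^ 2 / 2) * Φ (-s - m / s))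
        + (b / (b + 1) * a / (a - 1) - b / (b + 1)) *
          (Real.exp (a * m + a ^ 2 * s ^ 2 / 2) * Φ (-(a * s) - m / s)) := by
  set N := gaussianReal m (Real.toNNReal (s ^ 2)) with hN
  have h1 : Integrable (fun z => Real.exp z) N := by
    simpa using integrable_exp_mul_gaussianReal (μ := m) (v := Real.toNNReal (s ^ 2)) 1
  have ha : Integrable (fun z => Real.exp (a * z)) N := integrable_exp_mul_gaussianReal a
  have e1 : ∫ z in Iic 0, Real.exp z ∂N = Real.exp (m + s ^ 2 / 2) * Φ (-s - m / s) := by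
    have := setIntegral_exp_gaussianReal m 1 hs
    simp only [one_mul, one_pow] at this
    rw [this]
    ring_nf
  have e2 : ∫ z in Iic 0, Real.exp (a * z) ∂N =
      Real.exp (a * m + a ^ 2 * s ^ 2 / 2) * Φ (-(a * s) - m / s) := by
    rw [setIntegral_exp_gaussianReal m a hs]
    ring_nf
  have e0 : N.real (Iic 0) = Φ (-(m / s)) := gaussianReal_real_Iic_zero m hs
  have e3 : N.real (Ioi 0) = 1 - Φ (-(m / s)) := by
    rw [← e0, ← compl_Iic, probReal_compl_eq_one_sub measurableSet_Iic]
  have hsum : ∀ A B : ℝ, ∫ z in Iic 0, (1 - A * Real.exp z + B * Real.exp (a * z)) ∂N =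
      Φ (-(m / s)) - A * (Real.exp (m + s ^ 2 / 2) * Φ (-s - m / s)) +
        B * (Real.exp (a * m + a ^ 2 * s ^ 2 / 2) * Φ (-(a * s) - m / s)) := by
    intro A B
    have i1 : IntegrableOn (fun z => A * Real.exp z) (Iic 0) N := (h1.const_mul A).integrableOn
    have i2 : IntegrableOn (fun z => B * Real.exp (a * z)) (Iic 0) N :=
      (ha.const_mul B).integrableOn
    have i0 : IntegrableOn (fun _ : ℝ => (1 : ℝ)) (Iic 0) N := (integrable_const 1).integrableOn
    have i3 : IntegrableOn (fun z => 1 - A * Real.exp z) (Iic 0) N := i0.sub i1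
    rw [integral_add i3 i2, integral_sub i0 i1, integral_const_mul, integral_const_mul,
      setIntegral_const, e0, e1, e2, smul_eq_mul, mul_one]
  rw [← integral_add_compl (measurableSet_Iic (a := (0 : ℝ))) (integrable_lossValue a b m _), compl_Iic,
    setIntegral_congr_fun (f := lossValue a b) (g := fun z => 1 - b / (b + 1) * a / (a - 1) * Real.exp z
        + (b / (b + 1) * a / (a - 1) - b / (b + 1)) * Real.exp (a * z)) measurableSet_Iic
      (fun z hz => if_pos hz),
    setIntegral_congr_fun (f := lossValue a b) (g := fun _ => 1 / (1 + b)) measurableSet_Ioi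
      (fun z hz => if_neg (not_le.2 hz)),
    setIntegral_const, ← hN, e3, hsum]
  simp only [smul_eq_mul]
  ring

lemma integrable_fillValue (a m : ℝ) (v : ℝ≥0) :
    Integrable (fillValue a) (gaussianReal m v) := by
  have h : fillValue a = (Iic (0 : ℝ)).piecewise (fun z => Real.exp (a * z) / a)
      (fun z => z + 1 / a) := by
    ext z
    simp [fillValue, piecewise]
  have hid : Integrable (fun x : ℝ => x) (gaussianReal m v) :=
    memLp_one_iff_integrable.1 (memLp_id_gaussianReal' 1 (by simp))
  rw [h]
  exact Integrable.piecewise measurableSet_Iic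
    ((integrable_exp_mul_gaussianReal a).div_const a).integrableOn
    (hid.add (integrable_const _)).integrableOn

lemma integral_fillValue (a m : ℝ) {s : ℝ} (hs : 0 < s) :
    ∫ z, fillValue a z ∂gaussianReal m (Real.toNNReal (s ^ 2)) =
      (Real.exp (a * m + a ^ 2 * s ^ 2 / 2) * Φ (-(a * s) - m / s)) / a
        + (m * Φ (m / s) + s / √(2 * Real.pi) * Real.exp (-(m ^ 2 / (2 * s ^ 2)))
        + 1 / a * Φ (m / s)) := by
  set N := gaussianReal m (Real.toNNReal (s ^ 2)) with hN
  have hid : Integrable (fun x : ℝ => x) N :=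
    memLp_one_iff_integrable.1 (memLp_id_gaussianReal' 1 (by simp))
  have e2 : ∫ z in Iic 0, Real.exp (a * z) ∂N =
      Real.exp (a * m + a ^ 2 * s ^ 2 / 2) * Φ (-(a * s) - m / s) := by
    rw [setIntegral_exp_gaussianReal m a hs]
    ring_nf
  have e3 : N.real (Ioi 0) = Φ (m / s) := gaussianReal_real_Ioi_zero m hs
  rw [← integral_add_compl (measurableSet_Iic (a := (0 : ℝ))) (integrable_fillValue a m _), compl_Iic,
    setIntegral_congr_fun (f := fillValue a) (g := fun z => Real.exp (a * z) / a) measurableSet_Iic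
      (fun z hz => if_pos hz),
    setIntegral_congr_fun (f := fillValue a) (g := fun z => z + 1 / a) measurableSet_Ioi
      (fun z hz => if_neg (not_le.2 hz)),
    integral_add hid.integrableOn (integrable_const _).integrableOn,
    integral_div, setIntegral_const, e2, e3, setIntegral_id_gaussianReal m hs]
  simp only [smul_eq_mul]
  ring

/-! ### Measurability, integrability and real-valued formulas at exit. -/

lemma measurable_exitIndex (z : ℝ) : Measurable (exitIndex z) := by
  refine measurable_to_countable' fun n => ?_
  -- Sequences that never exit also receive index `0`, the default value of `sInf ∅`.
  have h : exitIndex z ⁻¹' {n} = (aliveSet z n ∩ {x | walk z x (n + 1) ≤ 0}) ∪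
      (if n = 0 then ⋂ k, aliveSet z k else ∅) := by
    ext x
    simp only [mem_preimage, mem_singleton_iff, mem_union, mem_inter_iff, mem_ofPred_eq]
    by_cases hx : ∃ n, walk z x (n + 1) ≤ 0
    · have h1 : x ∉ (if n = 0 then ⋂ k, aliveSet z k else ∅ : Set (ℕ → ℝ)) := by
        obtain ⟨m, hm⟩ := hx
        split_ifs
        · intro hmem
          exact not_lt.2 hm (mem_iInter.1 hmem (m + 1) m (Nat.lt_succ_self m))
        · simp
      simp only [h1, or_false]
      constructor
      · rintro rfl
        exact ⟨(le_exitIndex_iff hx _).1 le_rfl, Nat.sInf_mem hx⟩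
      · exact fun h => exitIndex_eq_of_mem h.1 h.2
    · have h0 : {n | walk z x (n + 1) ≤ 0} = ∅ := by
        ext n
        simpa using fun h => hx ⟨n, h⟩
      have h1 : exitIndex z x = 0 := by simp [exitIndex, h0]
      push Not at hx
      have h2 : ∀ k, x ∈ aliveSet z k := fun k j _ => hx j
      rw [h1]
      by_cases hn : n = 0
      · subst hn
        simp [h2]
      · simp [hn, hx n, Ne.symm hn]
  rw [h]
  refine ((measurableSet_aliveSet z n).inter
    (measurableSet_le (measurable_walk z (n + 1)) measurable_const)).union ?_
  split_ifs
  · exact MeasurableSet.iInter fun k => measurableSet_aliveSet z k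
  · exact MeasurableSet.empty

namespace IsExpWalk

variable {Ω : Type*} [MeasurableSpace Ω] {Pr : Measure Ω} {a b r : ℝ} {E X : ℕ → Ω → ℝ}

lemma measurable_exitIndex_steps (h : IsExpWalk Pr a b r E X) (z : ℝ) :
    Measurable (fun ω => exitIndex z (fun i => X i ω)) :=
  (measurable_exitIndex z).comp h.measurable_steps

lemma measurable_exit_walk (h : IsExpWalk Pr a b r E X) (z : ℝ) :
    Measurable (fun ω => walk z (fun i => X i ω) (exitIndex z (fun i => X i ω) + 1)) := by
  have h1 : Measurable (fun p : Ω × ℕ => walk z (fun i => X i p.1) (p.2 + 1)) :=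
    measurable_from_prod_countable_left fun n =>
      (measurable_walk z (n + 1)).comp h.measurable_steps
  exact h1.comp (measurable_id.prodMk (h.measurable_exitIndex_steps z))

lemma measurable_exit_time (h : IsExpWalk Pr a b r E X) (z : ℝ) :
    Measurable (fun ω => ∑ k ∈ Finset.range (exitIndex z (fun i => X i ω) + 1), E k ω) := by
  have h1 : Measurable (fun p : Ω × ℕ => ∑ k ∈ Finset.range (p.2 + 1), E k p.1) :=
    measurable_from_prod_countable_left fun n =>
      Finset.measurable_sum (Finset.range (n + 1)) fun k _ => h.measurable_gap k
  exact h1.comp (measurable_id.prodMk (h.measurable_exitIndex_steps z))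

lemma ae_gap_nonneg (h : IsExpWalk Pr a b r E X) : ∀ᵐ ω ∂Pr, ∀ n, 0 ≤ E n ω :=
  ae_all_iff.2 fun n => ae_of_ae_map (h.measurable_gap n).aemeasurable
    (by rw [h.map_gap]; exact ae_nonneg_expMeasure r)

variable [IsProbabilityMeasure Pr]

lemma ae_exit_walk_nonpos (h : IsExpWalk Pr a b r E X) (ha : 0 < a) (hb : 0 < b)
    (hba : b < a) (z : ℝ) :
    ∀ᵐ ω ∂Pr, walk z (fun i => X i ω) (exitIndex z (fun i => X i ω) + 1) ≤ 0 := by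
  filter_upwards [h.ae_exists_walk_nonpos ha hb hba z] with ω hω
  exact Nat.sInf_mem hω

lemma integrable_loss (h : IsExpWalk Pr a b r E X) (ha : 0 < a) (hb : 0 < b)
    (hba : b < a) (z : ℝ) :
    Integrable (fun ω => 1 - Real.exp (walk z (fun i => X i ω)
      (exitIndex z (fun i => X i ω) + 1))) Pr := by
  refine (integrable_const (1 : ℝ)).mono
    (measurable_const.sub (h.measurable_exit_walk z).exp).aestronglyMeasurable ?_
  filter_upwards [h.ae_exit_walk_nonpos ha hb hba z] with ω hω
  have h1 := Real.exp_le_one_iff.2 hω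
  have h2 := Real.exp_pos (walk z (fun i => X i ω) (exitIndex z (fun i => X i ω) + 1))
  rw [Real.norm_eq_abs, abs_of_nonneg (by linarith)]
  simp
  linarith

lemma integral_loss (h : IsExpWalk Pr a b r E X) (ha : 0 < a) (hb : 0 < b)
    (hba : b < a) (z : ℝ) :
    ∫ ω, (1 - Real.exp (walk z (fun i => X i ω) (exitIndex z (fun i => X i ω) + 1))) ∂Pr =
      (∫⁻ u, ∫⁻ v, ENNReal.ofReal (lossProfile (1 / (1 + b)) (z + (u - v)))
        ∂expMeasure b ∂expMeasure a).toReal := by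
  rw [← h.lintegral_loss ha hb hba z, integral_eq_lintegral_of_nonneg_ae]
  · filter_upwards [h.ae_exit_walk_nonpos ha hb hba z] with ω hω
    simpa using hω
  · exact (measurable_const.sub (h.measurable_exit_walk z).exp).aestronglyMeasurable

lemma integral_loss_of_nonneg (h : IsExpWalk Pr a b r E X) (ha : 0 < a) (hb : 0 < b)
    (hba : b < a) {z : ℝ} (hz : 0 ≤ z) :
    ∫ ω, (1 - Real.exp (walk z (fun i => X i ω) (exitIndex z (fun i => X i ω) + 1))) ∂Pr =
      1 / (1 + b) := by
  rw [h.integral_loss ha hb hba, lintegral_lossProfile_sub_of_nonneg ha hb hz,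
    ENNReal.toReal_ofReal (by positivity)]

lemma integral_loss_eq_lossValue (h : IsExpWalk Pr a b r E X) (ha : 0 < a) (ha1 : a ≠ 1)
    (hb : 0 < b) (hba : b < a) (z : ℝ) :
    ∫ ω, (1 - Real.exp (walk z (fun i => X i ω) (exitIndex z (fun i => X i ω) + 1))) ∂Pr =
      lossValue a b z := by
  rcases lt_or_ge z 0 with hz | hz
  · rw [h.integral_loss ha hb hba, lintegral_lossProfile_sub_of_neg ha ha1 hb hz]
  · rw [h.integral_loss_of_nonneg ha hb hba hz, lossValue]
    split_ifs with h0
    -- At `z = 0` the two branches of `lossValue` agree.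
    · have : z = 0 := le_antisymm h0 hz
      subst this
      simp
      field_simp
      ring
    · rfl

lemma lintegral_ofReal_exit_time (h : IsExpWalk Pr a b r E X) (ha : 0 < a) (hb : 0 < b)
    (hba : b < a) (hr : 0 < r) (z : ℝ) :
    ∫⁻ ω, ENNReal.ofReal (∑ k ∈ Finset.range (exitIndex z (fun i => X i ω) + 1), E k ω) ∂Pr =
      ENNReal.ofReal (1 / r + fillValue a z / (r * (1 / b - 1 / a))) := by
  have hq : 0 < 1 / b - 1 / a := sub_pos.2 (one_div_lt_one_div_of_lt hb hba)
  have hf := fillValue_nonneg ha z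
  have h1 := h.lintegral_exit_time ha hb hba hr z
  rw [lintegral_ofReal_add ha] at h1
  have h2 : ∫⁻ ω, ENNReal.ofReal (∑ k ∈ Finset.range (exitIndex z (fun i => X i ω) + 1), E k ω)
      ∂Pr = ∫⁻ ω, ∑ k ∈ Finset.range (exitIndex z (fun i => X i ω) + 1),
        ENNReal.ofReal (E k ω) ∂Pr := by
    refine lintegral_congr_ae ?_
    filter_upwards [h.ae_gap_nonneg] with ω hω
    exact ENNReal.ofReal_sum_of_nonneg fun k _ => hω k
  rw [h2]
  refine (ENNReal.mul_right_inj (ENNReal.ofReal_pos.2 hq).ne' ENNReal.ofReal_ne_top).1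
    (h1.trans ?_)
  rw [← ENNReal.ofReal_add hq.le hf, ← ENNReal.ofReal_mul (by positivity),
    ← ENNReal.ofReal_mul hq.le]
  congr 1
  have hab : a - b ≠ 0 := (sub_pos.2 hba).ne'
  field_simp

lemma integrable_exit_time (h : IsExpWalk Pr a b r E X) (ha : 0 < a) (hb : 0 < b)
    (hba : b < a) (hr : 0 < r) (z : ℝ) :
    Integrable (fun ω => ∑ k ∈ Finset.range (exitIndex z (fun i => X i ω) + 1), E k ω) Pr := by
  refine (lintegral_ofReal_ne_top_iff_integrable
    (h.measurable_exit_time z).aestronglyMeasurable ?_).1 ?_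
  · filter_upwards [h.ae_gap_nonneg] with ω hω
    exact Finset.sum_nonneg fun k _ => hω k
  · rw [h.lintegral_ofReal_exit_time ha hb hba hr z]
    exact ENNReal.ofReal_ne_top

lemma integral_exit_time (h : IsExpWalk Pr a b r E X) (ha : 0 < a) (hb : 0 < b)
    (hba : b < a) (hr : 0 < r) (z : ℝ) :
    ∫ ω, ∑ k ∈ Finset.range (exitIndex z (fun i => X i ω) + 1), E k ω ∂Pr =
      1 / r + fillValue a z / (r * (1 / b - 1 / a)) := by
  have hq : 0 < 1 / b - 1 / a := sub_pos.2 (one_div_lt_one_div_of_lt hb hba)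
  have hf := fillValue_nonneg ha z
  rw [integral_eq_lintegral_of_nonneg_ae, h.lintegral_ofReal_exit_time ha hb hba hr z,
    ENNReal.toReal_ofReal (by positivity)]
  · filter_upwards [h.ae_gap_nonneg] with ω hω
    exact Finset.sum_nonneg fun k _ => hω k
  · exact (h.measurable_exit_time z).aestronglyMeasurable

end IsExpWalk

/-! ### From the auction to the walk. -/

lemma sum_gapStep_fst (δ σ : ℝ) (w : ℝ≥0 → ℝ) (t : ℕ → ℝ≥0) (n : ℕ) :
    ∑ i ∈ Finset.range n, (gapStep δ σ w t i).1 = prevTime t n := by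
  induction n with
  | zero => simp [prevTime]
  | succ n ih =>
    rw [Finset.sum_range_succ, ih]
    simp [gapStep, prevTime]

lemma walk_gapStep_snd (z δ σ : ℝ) (w : ℝ≥0 → ℝ) (t : ℕ → ℝ≥0) (n : ℕ) :
    walk z (fun i => (gapStep δ σ w t i).2) n =
      z - δ * prevTime t n - σ * (w (prevTime t n) - w 0) := by
  induction n with
  | zero => simp [prevTime, walk]
  | succ n ih =>
    rw [walk_succ, ih]
    simp only [gapStep, prevTime]
    ring

section

variable {Ω : Type*} {lam μ σ P₀ δ : ℝ}

lemma fairPrice_pos (hP₀ : 0 < P₀) (W : ℝ≥0 → Ω → ℝ) (t : ℝ≥0) (ω : Ω) :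
    0 < fairPrice μ σ P₀ W t ω := by
  unfold fairPrice
  positivity

lemma askPrice_div_fairPrice (hP₀ : 0 < P₀) (hδ : δ = lam + μ - σ ^ 2 / 2) (W : ℝ≥0 → Ω → ℝ)
    (z : ℝ) (t : ℝ≥0) (ω : Ω) :
    askPrice lam (P₀ * Real.exp z) t / fairPrice μ σ P₀ W t ω =
      Real.exp (z - δ * t - σ * W t ω) := by
  have h : z - δ * t - σ * W t ω =
      z + -lam * t - ((μ - σ ^ 2 / 2) * t + σ * W t ω) := by rw [hδ]; ring
  rw [h, Real.exp_sub, Real.exp_add, askPrice, fairPrice]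
  field_simp

lemma logMispricing_eq (hP₀ : 0 < P₀) (hδ : δ = lam + μ - σ ^ 2 / 2) (W : ℝ≥0 → Ω → ℝ)
    (z : ℝ) (t : ℝ≥0) (ω : Ω) :
    logMispricing lam μ σ (P₀ * Real.exp z) P₀ W t ω = z - δ * t - σ * W t ω := by
  rw [logMispricing, askPrice_div_fairPrice hP₀ hδ, Real.log_exp]

lemma relativeLoss_eq (hP₀ : 0 < P₀) (hδ : δ = lam + μ - σ ^ 2 / 2) (W : ℝ≥0 → Ω → ℝ)
    (T : ℕ → Ω → ℝ≥0) (z : ℝ) (ω : Ω) :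
    relativeLoss lam μ σ (P₀ * Real.exp z) P₀ W T ω =
      1 - Real.exp (logMispricing lam μ σ (P₀ * Real.exp z) P₀ W
        (fillTime lam μ σ (P₀ * Real.exp z) P₀ W T ω) ω) := by
  rw [relativeLoss, sub_div, div_self (fairPrice_pos hP₀ W _ ω).ne',
    askPrice_div_fairPrice hP₀ hδ, logMispricing_eq hP₀ hδ]

end

section

variable {Ω : Type*} [MeasurableSpace Ω] {Pr : Measure Ω} [IsProbabilityMeasure Pr]
  {lam μ σ P₀ δ r a b : ℝ} {W : ℝ≥0 → Ω → ℝ} {T : ℕ → Ω → ℝ≥0}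

/-- At the block times the log mispricing is a random walk with exponential-difference steps. -/
lemma exists_isExpWalk (hσ : 0 < σ) (hP₀ : 0 < P₀) (hδ : δ = lam + μ - σ ^ 2 / 2)
    (ha : 0 < a) (hb : 0 < b) (hr : r = σ ^ 2 * (a * b) / 2) (hab : δ = σ ^ 2 * (a - b) / 2)
    (hW : IsBrownianReal W Pr) (hT : IsPoissonArrivals T r Pr)
    (hWT : IndepFun (fun ω (t : ℝ≥0) => W t ω) (fun ω (n : ℕ) => T n ω) Pr) :
    ∃ E X : ℕ → Ω → ℝ, IsExpWalk Pr a b r E X ∧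
      (∀ᵐ ω ∂Pr, ∀ n, ∑ k ∈ Finset.range (n + 1), E k ω = T n ω) ∧
      ∀ᵐ ω ∂Pr, ∀ z n, logMispricing lam μ σ (P₀ * Real.exp z) P₀ W (T n ω) ω =
        walk z (fun i => X i ω) (n + 1) := by
  have hr0 : 0 < r := by rw [hr]; positivity
  have := isProbabilityMeasure_expMeasure hr0
  have hm := aemeasurable_gapStep hW hT δ σ
  have hlaw := hasLaw_gapStep hW hr0 hT hWT δ σ
  -- The pairs are only a.e. measurable, so the walk is built from measurable representatives, equal
  -- to them for all `n` at once almost surely.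
  have hae : ∀ᵐ ω ∂Pr, ∀ n, gapStep δ σ (fun u => W u ω) (fun k => T k ω) n =
      (hm n).mk _ ω := ae_all_iff.2 fun n => (hm n).ae_eq_mk
  have hmap : ∀ n, Pr.map (hm n).mk = expMeasure r ⊗ₘ stepKernel δ σ := fun n => by
    rw [← (hlaw n).map_eq]
    exact Measure.map_congr (hm n).ae_eq_mk.symm
  refine ⟨fun n ω => ((hm n).mk _ ω).1, fun n ω => ((hm n).mk _ ω).2, ⟨?_, ?_, ?_, ?_, ?_⟩,
    ?_, ?_⟩
  · exact fun n => (hm n).measurable_mk.fst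
  · exact fun n => (hm n).measurable_mk.snd
  · exact (iIndepFun_gapStep hW hr0 hT hWT δ σ).congr fun n => (hm n).ae_eq_mk
  · intro n
    rw [← Function.comp_def Prod.fst, ← Measure.map_map measurable_fst (hm n).measurable_mk, hmap]
    exact Measure.fst_compProd _ _
  · intro n
    rw [← Function.comp_def Prod.snd, ← Measure.map_map measurable_snd (hm n).measurable_mk, hmap,
      ← stepKernel_comp_expMeasure ha hb hσ hr hab]
    exact Measure.snd_compProd _ _
  · filter_upwards [hae] with ω hω n
    simp only [← hω]
    exact sum_gapStep_fst δ σ _ _ (n + 1)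
  · filter_upwards [hae, hW.eval_zero_ae_eq_zero] with ω hω h0 z n
    simp only [← hω]
    rw [walk_gapStep_snd, logMispricing_eq hP₀ hδ, h0]
    simp [prevTime]

end

section

variable {Ω : Type*} [MeasurableSpace Ω] {Pr : Measure Ω} {lam μ σ P₀ δ : ℝ}
  {W : ℝ≥0 → Ω → ℝ} {T : ℕ → Ω → ℝ≥0} {E X : ℕ → Ω → ℝ}

lemma ae_relativeLoss_eq (hP₀ : 0 < P₀) (hδ : δ = lam + μ - σ ^ 2 / 2)
    (h : ∀ᵐ ω ∂Pr, ∀ z n, logMispricing lam μ σ (P₀ * Real.exp z) P₀ W (T n ω) ω =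
      walk z (fun i => X i ω) (n + 1)) (z : ℝ) :
    (fun ω => 1 - Real.exp (walk z (fun i => X i ω) (exitIndex z (fun i => X i ω) + 1)))
      =ᵐ[Pr] relativeLoss lam μ σ (P₀ * Real.exp z) P₀ W T := by
  filter_upwards [h] with ω hω
  rw [relativeLoss_eq hP₀ hδ, fillTime, hω]
  simp only [hω]
  rfl

lemma ae_fillTime_eq
    (hE : ∀ᵐ ω ∂Pr, ∀ n, ∑ k ∈ Finset.range (n + 1), E k ω = T n ω)
    (h : ∀ᵐ ω ∂Pr, ∀ z n, logMispricing lam μ σ (P₀ * Real.exp z) P₀ W (T n ω) ω =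
      walk z (fun i => X i ω) (n + 1)) (z : ℝ) :
    (fun ω => ∑ k ∈ Finset.range (exitIndex z (fun i => X i ω) + 1), E k ω)
      =ᵐ[Pr] fun ω => (fillTime lam μ σ (P₀ * Real.exp z) P₀ W T ω : ℝ) := by
  filter_upwards [hE, h] with ω hEω hω
  rw [fillTime, hEω]
  simp only [hω]
  rfl

end

end DutchAuction

/-! ### Identification of the constants. -/

theorem mainTheorem6
    {Ω : Type*} [MeasurableSpace Ω] (Pr : Measure Ω) [IsProbabilityMeasure Pr]
    (lam μ σ Δt P₀ δ : ℝ) (hlam : 0 < lam) (hσ : 0 < σ) (hΔt : 0 < Δt) (hP₀ : 0 < P₀)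
    (hδ_def : δ = lam + μ - σ ^ 2 / 2) (hδ : 0 < δ)
    (W : ℝ≥0 → Ω → ℝ) (hW : IsBrownianReal W Pr)
    (T : ℕ → Ω → ℝ≥0) (hT : IsPoissonArrivals T Δt⁻¹ Pr)
    (hWT : IndepFun (fun ω (t : ℝ≥0) => W t ω) (fun ω (n : ℕ) => T n ω) Pr)
    {Ω₀ : Type*} [MeasurableSpace Ω₀] (Q : Measure Ω₀) [IsProbabilityMeasure Q]
    (μ₀ σ₀ : ℝ) (hσ₀ : 0 < σ₀)
    (z₀ : Ω₀ → ℝ) (hz₀ : HasLaw z₀ (gaussianReal μ₀ (Real.toNNReal (σ₀ ^ 2))) Q) :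
    -- `LVF` and `FT` are well defined
    (∀ z : ℝ,
      (∀ᵐ ω ∂Pr, ∃ n, logMispricing lam μ σ (P₀ * Real.exp z) P₀ W (T n ω) ω ≤ 0) ∧
      Integrable (fun ω => relativeLoss lam μ σ (P₀ * Real.exp z) P₀ W T ω) Pr ∧
      Integrable (fun ω => (fillTime lam μ σ (P₀ * Real.exp z) P₀ W T ω : ℝ)) Pr) ∧
    -- the constants in the formulas
    LVF lam μ σ P₀ W T Pr 0 = LVFplus δ σ Δt ∧
    FT lam μ σ P₀ W T Pr 0 = Δt / 2 * (1 + √(1 + 2 * σ ^ 2 / (δ ^ 2 * Δt))) ∧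
    -- expected loss-versus-fair
    (σ ^ 2 / 2 - δ - Δt⁻¹ ≠ 0 →
      Integrable (fun ω => LVF lam μ σ P₀ W T Pr (z₀ ω)) Q ∧
      ∫ ω, LVF lam μ σ P₀ W T Pr (z₀ ω) ∂Q =
        LVFplus δ σ Δt + (1 - LVFplus δ σ Δt) * Φ (-(μ₀ / σ₀))
        + Δt⁻¹ * Real.exp (σ₀ ^ 2 / 2) / (σ ^ 2 / 2 - δ - Δt⁻¹) * Real.exp μ₀
            * Φ (-σ₀ - μ₀ / σ₀)
        + (LVFplus δ σ Δt - (σ ^ 2 / 2 - δ) / (σ ^ 2 / 2 - δ - Δt⁻¹))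
            * Real.exp (Δt⁻¹ * σ₀ ^ 2 / σ ^ 2
                + δ / σ ^ 2 * (δ / σ ^ 2 * σ₀ ^ 2 + μ₀)
                  * (√(1 + 2 * Δt⁻¹ * σ ^ 2 / δ ^ 2) + 1))
            * Φ (-(δ * σ₀ / σ ^ 2 * (√(1 + 2 * Δt⁻¹ * σ ^ 2 / δ ^ 2) + 1)) - μ₀ / σ₀)) ∧
    -- expected time-to-fill
    (Integrable (fun ω => FT lam μ σ P₀ W T Pr (z₀ ω)) Q ∧
      ∫ ω, FT lam μ σ P₀ W T Pr (z₀ ω) ∂Q =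
        Δt + σ₀ / (δ * √(2 * Real.pi)) * Real.exp (-(μ₀ ^ 2 / (2 * σ₀ ^ 2)))
        + (FT lam μ σ P₀ W T Pr 0 - Δt + μ₀ / δ) * Φ (μ₀ / σ₀)
        + (FT lam μ σ P₀ W T Pr 0 - Δt)
            * Real.exp (2 * Δt⁻¹ * FT lam μ σ P₀ W T Pr 0
                * (σ₀ ^ 2 * δ ^ 2 / σ ^ 4 + μ₀ * δ / σ ^ 2) + Δt⁻¹ * σ₀ ^ 2 / σ ^ 2)
            * Φ (-(2 * Δt⁻¹ * FT lam μ σ P₀ W T Pr 0 * σ₀ * δ / σ ^ 2) - μ₀ / σ₀)) := by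
  set S : ℝ := √(1 + 2 * σ ^ 2 / (δ ^ 2 * Δt)) with hS
  have hS' : √(1 + 2 * Δt⁻¹ * σ ^ 2 / δ ^ 2) = S := by
    rw [hS]
    congr 1
    field_simp
  rw [hS']
  have hS2 : S ^ 2 = 1 + 2 * σ ^ 2 / (δ ^ 2 * Δt) := Real.sq_sqrt (by positivity)
  have hS1 : 1 < S := by
    rw [hS, Real.lt_sqrt zero_le_one, one_pow]
    have : 0 < 2 * σ ^ 2 / (δ ^ 2 * Δt) := by positivity
    linarith
  have hS1' : 0 < S - 1 := sub_pos.2 hS1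
  -- The rates are the solution of `a b = 2 Δt⁻¹ / σ²`, `a - b = 2 δ / σ²`; they are kept opaque so
  -- that the algebra runs on these two relations.
  obtain ⟨a, ha_def⟩ : ∃ a, a = δ / σ ^ 2 * (S + 1) := ⟨_, rfl⟩
  obtain ⟨b, hb_def⟩ : ∃ b, b = δ / σ ^ 2 * (S - 1) := ⟨_, rfl⟩
  have ha : 0 < a := by rw [ha_def]; positivity
  have hb : 0 < b := by rw [hb_def]; positivity
  have hba : b < a := by
    rw [ha_def, hb_def]
    have : 0 < δ / σ ^ 2 := by positivity
    nlinarith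
  have hr : Δt⁻¹ = σ ^ 2 * (a * b) / 2 := by
    have : σ ^ 2 * (a * b) / 2 = δ ^ 2 / σ ^ 2 * (S ^ 2 - 1) / 2 := by
      rw [ha_def, hb_def]; field_simp; ring
    rw [this, hS2]
    field_simp
    ring
  have hab : δ = σ ^ 2 * (a - b) / 2 := by rw [ha_def, hb_def]; field_simp; ring
  have hr0 : 0 < Δt⁻¹ := inv_pos.2 hΔt
  -- The mean drop per block is `δ Δt`.
  have hrq : Δt⁻¹ * (1 / b - 1 / a) = δ := by rw [hr, hab]; field_simp
  have hLVFp : LVFplus δ σ Δt = 1 / (1 + b) := by rw [LVFplus, ← hS, hb_def]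
  obtain ⟨E, X, hEX, hE, hX⟩ := exists_isExpWalk hσ hP₀ hδ_def ha hb hr hab hW hT hWT
  have hloss := ae_relativeLoss_eq hP₀ hδ_def hX
  have hfill := ae_fillTime_eq hE hX
  have hFT : ∀ z, FT lam μ σ P₀ W T Pr z = Δt + fillValue a z / δ := fun z => by
    rw [FT, ← integral_congr_ae (hfill z), hEX.integral_exit_time ha hb hba hr0, hrq,
      one_div, inv_inv]
  have hFT0 : FT lam μ σ P₀ W T Pr 0 = Δt + 1 / (a * δ) := by
    rw [hFT]
    simp [fillValue]
    field_simp
  have hFT0' : Δt + 1 / (a * δ) = Δt / 2 * (1 + S) := by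
    have h1 : a * b = 2 * Δt⁻¹ / σ ^ 2 := by rw [hr]; field_simp
    have h2 : 1 / a = b * (Δt * σ ^ 2 / 2) := by
      field_simp
      field_simp at h1
      linarith
    have h3 : 1 / (a * δ) = 1 / a / δ := by field_simp
    rw [h3, h2, hb_def]
    field_simp
    ring
  refine ⟨fun z => ⟨?_, ?_, ?_⟩, ?_, ?_, ?_, ?_⟩
  · filter_upwards [hX, hEX.ae_exists_walk_nonpos ha hb hba z] with ω hω hex
    obtain ⟨n, hn⟩ := hex
    exact ⟨n, by rwa [hω]⟩
  · exact (hEX.integrable_loss ha hb hba z).congr (hloss z)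
  · exact (hEX.integrable_exit_time ha hb hba hr0 z).congr (hfill z)
  · rw [LVF, ← integral_congr_ae (hloss 0), hEX.integral_loss_of_nonneg ha hb hba le_rfl, hLVFp]
  · rw [hFT0, hFT0']
  · intro hD
    -- The assumption of (a) thus says exactly that `a ≠ 1`.
    have hDab : σ ^ 2 / 2 - δ - Δt⁻¹ = σ ^ 2 / 2 * (1 - a) * (1 + b) := by
      rw [hr, hab]; ring
    have ha1 : a ≠ 1 := fun h => hD (by rw [hDab, h]; ring)
    have ha1' : a - 1 ≠ 0 := sub_ne_zero.2 ha1
    have ha1'' : 1 - a ≠ 0 := sub_ne_zero.2 ha1.symm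
    have hL : ∀ z, LVF lam μ σ P₀ W T Pr z = lossValue a b z := fun z => by
      rw [LVF, ← integral_congr_ae (hloss z), hEX.integral_loss_eq_lossValue ha ha1 hb hba]
    simp only [hL]
    have hi := integrable_lossValue a b μ₀ (Real.toNNReal (σ₀ ^ 2))
    rw [← hz₀.map_eq] at hi
    refine ⟨hi.comp_aemeasurable hz₀.aemeasurable, ?_⟩
    have hint := hz₀.integral_comp (f := lossValue a b) (by rw [← hz₀.map_eq]; exact hi.1)
    rw [Function.comp_def] at hint
    rw [hint, integral_lossValue a b μ₀ hσ₀, hLVFp, hDab]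
    have e1 : δ * σ₀ / σ ^ 2 * (S + 1) = a * σ₀ := by rw [ha_def]; ring
    have e2 : Δt⁻¹ * σ₀ ^ 2 / σ ^ 2 + δ / σ ^ 2 * (δ / σ ^ 2 * σ₀ ^ 2 + μ₀) * (S + 1) =
        a * μ₀ + a ^ 2 * σ₀ ^ 2 / 2 := by
      have h1 : δ / σ ^ 2 * (δ / σ ^ 2 * σ₀ ^ 2 + μ₀) * (S + 1) =
          a * (δ / σ ^ 2 * σ₀ ^ 2 + μ₀) := by rw [ha_def]; ring
      rw [h1, hr, hab]
      field_simp
      ring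
    have e3 : Δt⁻¹ / (σ ^ 2 / 2 * (1 - a) * (1 + b)) = -(b / (b + 1) * a / (a - 1)) := by
      rw [hr]
      field_simp
      ring
    have e4 : 1 / (1 + b) - (σ ^ 2 / 2 - δ) / (σ ^ 2 / 2 * (1 - a) * (1 + b)) =
        b / (b + 1) * a / (a - 1) - b / (b + 1) := by
      rw [hab]
      field_simp
      ring
    rw [e1, e2, e4, Real.exp_add μ₀, mul_div_right_comm Δt⁻¹, e3]
    ring
  · simp only [hFT]
    have hi := (integrable_fillValue a μ₀ (Real.toNNReal (σ₀ ^ 2)))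
    have hi' := hi
    rw [← hz₀.map_eq] at hi
    have hi2 : Integrable (fun ω => fillValue a (z₀ ω) / δ) Q :=
      (hi.comp_aemeasurable hz₀.aemeasurable).div_const δ
    refine ⟨(integrable_const Δt).add hi2, ?_⟩
    have hint := hz₀.integral_comp (f := fillValue a) hi'.1
    simp only [Function.comp_apply] at hint
    rw [integral_add (integrable_const Δt) hi2, integral_div, hint,
      integral_fillValue a μ₀ hσ₀]
    rw [← hFT 0, hFT0]
    -- Both sides equal `S + 1`; this brings the exponents written with `FT 0` back to the rate `a`.
    have h2r : 2 * Δt⁻¹ * (Δt + 1 / (a * δ)) = σ ^ 2 / δ * a := by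
      rw [hFT0', ha_def]
      field_simp
      ring
    have e1 : 2 * Δt⁻¹ * (Δt + 1 / (a * δ)) * σ₀ * δ / σ ^ 2 = a * σ₀ := by
      rw [h2r]; field_simp
    have e2 : 2 * Δt⁻¹ * (Δt + 1 / (a * δ)) * (σ₀ ^ 2 * δ ^ 2 / σ ^ 4 + μ₀ * δ / σ ^ 2) +
        Δt⁻¹ * σ₀ ^ 2 / σ ^ 2 = a * μ₀ + a ^ 2 * σ₀ ^ 2 / 2 := by
      rw [h2r, hr]
      have h3 : σ ^ 2 / δ * a * (σ₀ ^ 2 * δ ^ 2 / σ ^ 4 + μ₀ * δ / σ ^ 2) =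
          a * (σ₀ ^ 2 * (δ / σ ^ 2) + μ₀) := by field_simp
      rw [h3, hab]
      field_simp
      ring
    rw [e1, e2]
    simp only [integral_const, probReal_univ, one_smul]
    field_simp
    ring
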